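/- Let $N$ be odd and let $N$ processors, numbered $1,\dots,N$ clockwise, be arranged in a ring. Fix $0<r<1$. In Herman's synchronous protocol, in each time step every processor that has a token passes it to its clockwise neighbour with probability $r$ and keeps it with probability $1-r$, independently of all other processors and time steps; if a processor keeps its token and receives another token from its counterclockwise neighbour, both of these tokens are annihilated. Let $M=2m+1$ with $3\le M\le N$ be odd, and suppose that initially exactly the processors $z(1)<\dots<z(M)$ (with $z(i)\in\{1,\dots,N\}$) have a token. Let $\mathbf T$ be the first time at which exactly one token is left. A *pairing* is a set $w=\{(u_1,v_1),\dots,(u_m,v_m)\}$ with $1\le u_i<v_i\le M$ for which there is $w_0$ with $\{u_1,v_1,\dots,u_m,v_m,w_0\}=\{1,\dots,M\}$; put $s(w)=1$ if the permutation of $\{1,\dots,M\}$ with one-line notation $(u_1v_1\cdots u_mv_mw_0)$ is even and $s(w)=-1$ otherwise (this does not depend on the order of the pairs). A *directed pairing* is a set $\vec w=\{(u_1,v_1,d_1),\dots,(u_m,v_m,d_m)\}$ with $d_i\in\{\downarrow,\uparrow\}$ such that $w=\{(u_1,v_1),\dots,(u_m,v_m)\}$ is a pairing; put $\vec s(\vec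 w)=s(w)\cdot(-1)^{|\{i\,:\,d_i=\uparrow\}|}$, and let $\vec W_M$ be the set of all directed pairings. For $1\le u<v\le M$ let $z_{uv\downarrow}=z(v)-z(u)$ and $z_{uv\uparrow}=N-(z(v)-z(u))$. Let $$g(j,y;u)=\frac{\sin(j\pi y)\,\sin(j\pi u)}{1-\cos(j\pi u)},\qquad h(j;u)=1-2r(1-r)\bigl(1-\cos(j\pi u)\bigr),$$ and, for $k\ge1$ and $\ell\ge0$, $$F^{(N)}(y_1,\dots,y_k)=-\Bigl(\frac{-1}{N}\Bigr)^{k}\sum_{j\in\{1,\dots,N-1\}^k}\frac{\prod_{i=1}^k g(j(i),y_i;1/N)}{1-\prod_{i=1}^k h(j(i);1/N)},\qquad G(y_1,\dots,y_\ell)=\prod_{i=1}^{\ell}(1-y_i),$$ where $G$ of no arguments is $1$. Both functions are symmetric in their arguments. For $\emptyset\ne\vec x\subseteq\vec w\in\vec W_M$ let $y_F(\vec x,\vec w)$ be the tuple of the numbers $z_{uvd}/N$ with $(u,v,d)\in\vec x$, and $y_G(\vec x,\vec w)$ the tuple of the numbers $z_{uvd}/N$ with $(u,v,d)\in\vec w\setminus\vec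 x$. Then $\mathbb E\,\mathbf T$ is finite and $$\mathbb E\,\mathbf T=\sum_{\vec w\in\vec W_M}\vec s(\vec w)\sum_{\emptyset\ne\vec x\subseteq\vec w}F^{(N)}\bigl(y_F(\vec x,\vec w)\bigr)\cdot G\bigl(y_G(\vec x,\vec w)\bigr).$$ -/

import Mathlib

open MeasureTheory ProbabilityTheory
open scoped ENNReal

noncomputable section

namespace Herman

/-! ### The synchronous protocol

Processors are the elements of `ZMod N`; the clockwise neighbour of `p` is `p + 1`.
A configuration is the set of processors that hold a token. -/

/-- One synchronous step from the configuration `C`: every processor `p ∈ C` with `pass p = true`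
passes its token to `p + 1`, every other processor of `C` keeps its token, and two tokens that are
then at the same processor annihilate each other (hence the symmetric difference). -/
def step {N : ℕ} (C : Finset (ZMod N)) (pass : ZMod N → Bool) : Finset (ZMod N) :=
  symmDiff (C.filter fun p => pass p = false)
    ((C.filter fun p => pass p = true).image fun p => p + 1)

/-- The configuration after `t` steps, started in `C₀`, when `coin t p` is the decision of
processor `p` in the step from time `t` to time `t + 1`. -/
def config {N : ℕ} (C₀ : Finset (ZMod N)) (coin : ℕ → ZMod N → Bool) : ℕ → Finset (ZMod N)
  | 0 => C₀
  | t + 1 => step (config C₀ coin t) (coin t)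

/-- The first time at which exactly one token is left (`⊤` if there is no such time). -/
def stabTime {N : ℕ} (C₀ : Finset (ZMod N)) (coin : ℕ → ZMod N → Bool) : ℕ∞ :=
  ⨅ (t : ℕ) (_ : (config C₀ coin t).card = 1), (t : ℕ∞)

/-- The random decisions of the processors: mutually independent over all times and processors,
each equal to `true` ("pass the token") with probability `r`. -/
structure IsCoinFamily {Ω : Type*} [MeasurableSpace Ω] (μ : Measure Ω) (N : ℕ) (r : ℝ)
    (coin : ℕ → ZMod N → Ω → Bool) : Prop where
  measurable : ∀ t p, Measurable (coin t p)
  indep : iIndepFun (fun i : ℕ × ZMod N => coin i.1 i.2) μ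
  prob : ∀ t p, μ {ω | coin t p ω = true} = ENNReal.ofReal r

/-- The expected time to stabilization, as an extended nonnegative number. -/
def expectedTime {Ω : Type*} [MeasurableSpace Ω] (μ : Measure Ω) {N : ℕ}
    (C₀ : Finset (ZMod N)) (coin : ℕ → ZMod N → Ω → Bool) : ℝ≥0∞ :=
  ∫⁻ ω, (stabTime C₀ (fun t p => coin t p ω) : ℝ≥0∞) ∂μ

/-! ### Pairings -/

/-- `w` consists of `m = (M - 1) / 2` pairs `(u, v)` with `u < v` which, together with one further
token `w₀`, exhaust all tokens. -/
def IsPairing {M : ℕ} (w : Finset (Fin M × Fin M)) : Prop :=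
  w.card = (M - 1) / 2 ∧ (∀ p ∈ w, p.1 < p.2) ∧
    ∃ w₀ : Fin M, insert w₀ (w.image Prod.fst ∪ w.image Prod.snd) = Finset.univ

/-- The permutation `σ`, written as the word `σ 0, σ 1, …, σ (M - 1)`, has the form
`u₁ v₁ ⋯ uₘ vₘ w₀` with `w = {(u₁, v₁), …, (uₘ, vₘ)}`. -/
def Arranges {M : ℕ} (σ : Equiv.Perm (Fin M)) (w : Finset (Fin M × Fin M)) : Prop :=
  w = Finset.univ.image fun i : Fin ((M - 1) / 2) =>
    (σ ⟨2 * i, by omega⟩, σ ⟨2 * i + 1, by omega⟩)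

open Classical in
/-- The sign of a pairing: `1` if the permutation `(u₁ v₁ ⋯ uₘ vₘ w₀)` is even, `-1` otherwise.
(The parity does not depend on the order in which the pairs are listed.) -/
def pairingSign {M : ℕ} (w : Finset (Fin M × Fin M)) : ℝ :=
  if ∃ σ : Equiv.Perm (Fin M), Arranges σ w ∧ Equiv.Perm.sign σ = 1 then 1 else -1

/-- The two ways in which a pair of tokens can collide. -/
inductive Direction
  | down
  | up
  deriving DecidableEq

instance : Fintype Direction where
  elems := {Direction.down, Direction.up}
  complete := fun d => by cases d <;> decide

/-- A directed pair `(u, v, d)`. -/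
abbrev DPair (M : ℕ) : Type := Fin M × Fin M × Direction

/-- Forget the directions. -/
def undirected {M : ℕ} (w : Finset (DPair M)) : Finset (Fin M × Fin M) :=
  w.image fun p => (p.1, p.2.1)

open Classical in
/-- The finite set of all directed pairings: `m` triples `(u, v, d)` whose underlying pairs form
a pairing. -/
def directedPairings (M : ℕ) : Finset (Finset (DPair M)) :=
  Finset.univ.filter fun w => w.card = (M - 1) / 2 ∧ IsPairing (undirected w)

/-- The sign of a directed pairing. -/
def dirSign {M : ℕ} (w : Finset (DPair M)) : ℝ :=
  pairingSign (undirected w) * (-1) ^ (w.filter fun p => p.2.2 = Direction.up).card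

/-! ### The functions in the closed formula -/

/-- The directed distance: `z v - z u` for `↓` and `N - (z v - z u)` for `↑`. -/
def dirDist {M : ℕ} (N : ℕ) (z : Fin M → ℕ) (p : DPair M) : ℝ :=
  match p.2.2 with
  | Direction.down => (z p.2.1 : ℝ) - z p.1
  | Direction.up => (N : ℝ) - ((z p.2.1 : ℝ) - z p.1)

/-- `g(j, y; u)`. -/
def g (j : ℕ) (y u : ℝ) : ℝ :=
  Real.sin (j * Real.pi * y) * Real.sin (j * Real.pi * u) / (1 - Real.cos (j * Real.pi * u))

/-- `h(j; u)`, with the passing probability `r`. -/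
def h (r : ℝ) (j : ℕ) (u : ℝ) : ℝ :=
  1 - 2 * r * (1 - r) * (1 - Real.cos (j * Real.pi * u))

/-- The function `F⁽ᴺ⁾` of `k = Fintype.card ι` real arguments, indexed by a finite type `ι`
(it does not depend on the order of its arguments). -/
def F (N : ℕ) (r : ℝ) {ι : Type*} [Fintype ι] [DecidableEq ι] (y : ι → ℝ) : ℝ :=
  -(-1 / (N : ℝ)) ^ Fintype.card ι *
    ∑ j ∈ Fintype.piFinset (fun _ : ι => Finset.Icc 1 (N - 1)),
      (∏ i, g (j i) (y i) (1 / N)) / (1 - ∏ i, h r (j i) (1 / N))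

/-- The function `G`, equal to `1` when there are no arguments. -/
def G {ι : Type*} [Fintype ι] (y : ι → ℝ) : ℝ :=
  ∏ i, (1 - y i)

/-- The family of the normalized directed distances of the members of `x`. -/
def yOf {M : ℕ} (N : ℕ) (z : Fin M → ℕ) (x : Finset (DPair M)) : x → ℝ :=
  fun p => dirDist N z p / N

/-- The initial configuration: the tokens are at the processors `z i`. -/
def initial {M : ℕ} (N : ℕ) (z : Fin M → ℕ) : Finset (ZMod N) :=
  Finset.univ.image fun i => (z i : ZMod N)

end Herman

end

/-! Let P_t(x) be `hit N r t x`, the chance that two tokens at clockwise distance x, taken alone,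
have closed that gap (rather than the complementary one) by time t. The heart is
`IsCyclic.pfaff_hit`: the probability that one token is left at time t equals `pfaff (hit N r t)`, a
Pfaffian-like alternating sum over words u₁v₁⋯uₘvₘw₀ of products of values P_t, divided by m!.

Both sides satisfy the same recursion. From distinct processors, averaging over one step acts on
each factor separately, because a token occurs in at most one factor and the coins are independent;
P_t is built from eigenfunctions of the difference walk, so each factor becomes P_{t+1}
(`IsStrictCyclic.sum_pfaff_hit`). When neighbouring tokens collide, exchanging their labels cancels
all words that do not pair them together, and the remaining words carry the factor P(0) - P(N) = 1,
so both tokens may be deleted (`pairSum_remove`, `IsCyclic.exists_remove`). Rotation of the labels,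
an even permutation of an odd number of tokens, brings any collision to the first two labels. At
time 0, P_0 vanishes strictly between 0 and N, which leaves the indicator of a single token.

Now split P_t into the affine part 1 - x/N and a transient part. The affine part alone gives the
value 1 (`IsCyclic.pfaff_limit`), so the probability of not being finished is minus the sum of the
terms with at least one transient factor. These are combinations of geometric sequences; summing
over t produces `F`, and the tail-sum formula gives the expectation. Words are regrouped into
directed pairings, each of which comes from m! words of equal sign. -/

namespace Herman

open Equiv Equiv.Perm

/-! ### Alternating sums over permutations -/

/-- The position of the first member of the `i`-th pair. -/
def fstPos {m : ℕ} (i : Fin m) : Fin (2 * m + 1) := ⟨2 * i, by omega⟩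

/-- The position of the second member of the `i`-th pair. -/
def sndPos {m : ℕ} (i : Fin m) : Fin (2 * m + 1) := ⟨2 * i + 1, by omega⟩

/-- The positions of a word `u₁ v₁ ⋯ uₘ vₘ w₀`. -/
def posEquiv (m : ℕ) : (Fin m × Fin 2) ⊕ Fin 1 ≃ Fin (2 * m + 1) :=
  ((Equiv.sumCongr finProdFinEquiv (Equiv.refl (Fin 1))).trans finSumFinEquiv).trans
    (finCongr (by omega))

theorem posEquiv_fst {m : ℕ} (i : Fin m) : posEquiv m (Sum.inl (i, 0)) = fstPos i := by
  ext; simp [posEquiv, fstPos, finProdFinEquiv]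

theorem posEquiv_snd {m : ℕ} (i : Fin m) : posEquiv m (Sum.inl (i, 1)) = sndPos i := by
  ext; simp [posEquiv, sndPos, finProdFinEquiv]; omega

theorem posEquiv_last {m : ℕ} (i : Fin 1) : posEquiv m (Sum.inr i) = Fin.last (2 * m) := by
  ext; simp [posEquiv, Nat.mul_comm]

theorem fstPos_injective {m : ℕ} : Function.Injective (fstPos (m := m)) := by
  intro i j h; simp [fstPos] at h; omega

theorem sndPos_injective {m : ℕ} : Function.Injective (sndPos (m := m)) := by
  intro i j h; simp [sndPos] at h; omega

theorem fstPos_ne_sndPos {m : ℕ} (i j : Fin m) : fstPos i ≠ sndPos j := by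
  intro h; simp [fstPos, sndPos] at h; omega

theorem forall_pos {m : ℕ} {p : Fin (2 * m + 1) → Prop} (h₁ : ∀ i, p (fstPos i))
    (h₂ : ∀ i, p (sndPos i)) (h₃ : p (Fin.last (2 * m))) (k : Fin (2 * m + 1)) : p k := by
  obtain ⟨x, rfl⟩ := (posEquiv m).surjective k
  rcases x with ⟨i, b⟩ | x
  · fin_cases b
    · simpa [posEquiv_fst] using h₁ i
    · simpa [posEquiv_snd] using h₂ i
  · simpa [posEquiv_last] using h₃

/-- The permutation of the positions that permutes the pairs by `τ`. -/
def pairPerm {m : ℕ} (τ : Perm (Fin m)) : Perm (Fin (2 * m + 1)) :=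
  (posEquiv m).permCongr (Equiv.Perm.sumCongr (Equiv.prodCongrLeft fun _ => τ) 1)

theorem pairPerm_fst {m : ℕ} (τ : Perm (Fin m)) (i : Fin m) :
    pairPerm τ (fstPos i) = fstPos (τ i) := by
  simp [pairPerm, Equiv.permCongr_apply, ← posEquiv_fst]

theorem pairPerm_snd {m : ℕ} (τ : Perm (Fin m)) (i : Fin m) :
    pairPerm τ (sndPos i) = sndPos (τ i) := by
  simp [pairPerm, Equiv.permCongr_apply, ← posEquiv_snd]

/-- The permutation τ acts on both members of the pairs, so its sign enters squared. Hence the order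
of the pairs never affects a sign. -/
theorem sign_pairPerm {m : ℕ} (τ : Perm (Fin m)) : sign (pairPerm τ) = 1 := by
  rw [pairPerm, sign_permCongr, sign_sumCongr, sign_prodCongrLeft]
  simp

/-- The permutation of the positions that exchanges the members of the pairs in `B`. -/
def flipPerm {m : ℕ} (B : Finset (Fin m)) : Perm (Fin (2 * m + 1)) :=
  (posEquiv m).permCongr (Equiv.Perm.sumCongr
    (Equiv.prodCongrRight fun i => if i ∈ B then swap 0 1 else 1) 1)

theorem flipPerm_fst {m : ℕ} (B : Finset (Fin m)) (i : Fin m) :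
    flipPerm B (fstPos i) = if i ∈ B then sndPos i else fstPos i := by
  split_ifs with hi <;> simp [flipPerm, Equiv.permCongr_apply, ← posEquiv_fst, ← posEquiv_snd, hi]

theorem flipPerm_snd {m : ℕ} (B : Finset (Fin m)) (i : Fin m) :
    flipPerm B (sndPos i) = if i ∈ B then fstPos i else sndPos i := by
  split_ifs with hi <;> simp [flipPerm, Equiv.permCongr_apply, ← posEquiv_fst, ← posEquiv_snd, hi]

theorem sign_flipPerm {m : ℕ} (B : Finset (Fin m)) : sign (flipPerm B) = (-1) ^ B.card := by
  rw [flipPerm, sign_permCongr, sign_sumCongr, sign_prodCongrRight]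
  simp [apply_ite sign]

/-- The alternating sum of the products `a u₁ v₁ ⋯ a uₘ vₘ` over all words `u₁ v₁ ⋯ uₘ vₘ w₀`. -/
noncomputable def pairSum {m : ℕ} (a : Fin (2 * m + 1) → Fin (2 * m + 1) → ℝ) : ℝ :=
  ∑ σ : Perm (Fin (2 * m + 1)), ((sign σ : ℤ) : ℝ) * ∏ i : Fin m, a (σ (fstPos i)) (σ (sndPos i))

theorem pairSum_zero (a : Fin (2 * 0 + 1) → Fin (2 * 0 + 1) → ℝ) : pairSum a = 1 := by
  simp [pairSum]

theorem pairSum_reindex {m : ℕ} (a : Fin (2 * m + 1) → Fin (2 * m + 1) → ℝ)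
    (ρ : Perm (Fin (2 * m + 1))) (hρ : sign ρ = 1) :
    pairSum (fun u v => a (ρ u) (ρ v)) = pairSum a := by
  unfold pairSum
  refine Fintype.sum_equiv (Equiv.mulLeft ρ) _ _ fun σ => ?_
  simp [hρ]

/-! ### Deleting two interchangeable labels -/

/-- A permutation of `Fin n`, extended by two fixed points at the start. -/
def extendTwo {n : ℕ} (e : Perm (Fin n)) : Perm (Fin (n + 2)) :=
  decomposeFin.symm (0, decomposeFin.symm (0, e))

theorem extendTwo_zero {n : ℕ} (e : Perm (Fin n)) : extendTwo e 0 = 0 := by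
  simp [extendTwo]

theorem extendTwo_one {n : ℕ} (e : Perm (Fin n)) : extendTwo e 1 = 1 := by
  rw [extendTwo, ← Fin.succ_zero_eq_one, decomposeFin_symm_apply_succ]; simp

theorem extendTwo_succ_succ {n : ℕ} (e : Perm (Fin n)) (i : Fin n) :
    extendTwo e i.succ.succ = (e i).succ.succ := by
  rw [extendTwo, decomposeFin_symm_apply_succ, decomposeFin_symm_apply_succ]; simp

theorem sign_extendTwo {n : ℕ} (e : Perm (Fin n)) : sign (extendTwo e) = sign e := by
  simp [extendTwo, decomposeFin.symm_sign]

theorem extendTwo_injective {n : ℕ} : Function.Injective (extendTwo (n := n)) := by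
  intro e f h
  ext i
  have := DFunLike.congr_fun h i.succ.succ
  rw [extendTwo_succ_succ, extendTwo_succ_succ] at this
  simpa using congrArg Fin.val this

theorem exists_extendTwo {n : ℕ} (σ : Perm (Fin (n + 2))) (h₀ : σ 0 = 0) (h₁ : σ 1 = 1) :
    ∃ e, extendTwo e = σ := by
  obtain ⟨⟨p, e⟩, rfl⟩ := decomposeFin.symm.surjective σ
  obtain rfl : p = 0 := by simpa using h₀
  obtain ⟨⟨q, f⟩, rfl⟩ := decomposeFin.symm.surjective e
  rw [← Fin.succ_zero_eq_one, decomposeFin_symm_apply_succ] at h₁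
  obtain rfl : q = 0 := by
    rw [decomposeFin_symm_apply_zero, swap_self, refl_apply] at h₁
    exact Fin.succ_injective _ h₁
  exact ⟨f, rfl⟩

/-- Moving the `i`-th pair to the front is an even change of word, so `i` may be taken to be 0; the
words starting with 0, 1 are exactly the extensions of words in the remaining labels. -/
theorem sum_with_fixed_pair {m : ℕ} (a : Fin (2 * (m + 1) + 1) → Fin (2 * (m + 1) + 1) → ℝ)
    (i : Fin (m + 1)) :
    (∑ σ : Perm (Fin (2 * (m + 1) + 1)), if σ (fstPos i) = 0 ∧ σ (sndPos i) = 1 then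
      ((sign σ : ℤ) : ℝ) * ∏ k, (if k = i then 1 else a (σ (fstPos k)) (σ (sndPos k))) else 0) =
    pairSum (m := m) fun u v => a u.succ.succ v.succ.succ := by
  set H : Perm (Fin (2 * (m + 1) + 1)) → ℝ := fun σ => if σ (fstPos 0) = 0 ∧ σ (sndPos 0) = 1 then
    ((sign σ : ℤ) : ℝ) * ∏ k, (if k = 0 then 1 else a (σ (fstPos k)) (σ (sndPos k))) else 0 with hH
  have key : ∀ σ : Perm (Fin (2 * (m + 1) + 1)),
      (if σ (fstPos i) = 0 ∧ σ (sndPos i) = 1 then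
        ((sign σ : ℤ) : ℝ) * ∏ k, (if k = i then 1 else a (σ (fstPos k)) (σ (sndPos k))) else 0) =
      H (Equiv.mulRight (pairPerm (swap 0 i)) σ) := by
    intro σ
    simp only [hH, coe_mulRight, Perm.mul_apply, pairPerm_fst, pairPerm_snd, swap_apply_left, Perm.sign_mul,
      sign_pairPerm, mul_one]
    rw [← Equiv.prod_comp (swap 0 i) fun k =>
      if k = i then 1 else a (σ (fstPos k)) (σ (sndPos k))]
    simp only [swap_apply_eq_iff, swap_apply_right]
  rw [Fintype.sum_equiv (Equiv.mulRight (pairPerm (swap 0 i))) _ H key]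
  refine (Fintype.sum_of_injective (fun e : Perm (Fin (2 * m + 1)) =>
    (extendTwo e : Perm (Fin (2 * m + 1 + 2)))) extendTwo_injective _ _ ?_ ?_).symm
  · intro σ hσ
    refine if_neg fun h => hσ ?_
    exact exists_extendTwo (n := 2 * m + 1) σ h.1 h.2
  · intro e
    have h₀ : (extendTwo e : Perm (Fin (2 * m + 1 + 2))) (fstPos (m := m + 1) 0) = 0 :=
      extendTwo_zero e
    have h₁ : (extendTwo e : Perm (Fin (2 * m + 1 + 2))) (sndPos (m := m + 1) 0) = 1 :=
      extendTwo_one e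
    rw [hH]
    beta_reduce
    rw [if_pos ⟨h₀, h₁⟩, Fin.prod_univ_succ]
    simp only [if_true, one_mul, Fin.succ_ne_zero, if_false]
    refine congr_arg₂ _ (by rw [← sign_extendTwo]) (Finset.prod_congr rfl fun k _ => ?_)
    rw [← extendTwo_succ_succ, ← extendTwo_succ_succ]
    rfl

/-- If the labels `0` and `1` are interchangeable, then they can be removed. -/
theorem pairSum_remove {m : ℕ} (a : Fin (2 * (m + 1) + 1) → Fin (2 * (m + 1) + 1) → ℝ)
    (hrow : ∀ x, x ≠ 0 → x ≠ 1 → a 0 x = a 1 x) (hcol : ∀ x, x ≠ 0 → x ≠ 1 → a x 0 = a x 1)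
    (h₁ : a 0 1 - a 1 0 = 1) :
    pairSum a = (m + 1) * pairSum (m := m) fun u v => a u.succ.succ v.succ.succ := by
  have h01 : (0 : Fin (2 * (m + 1) + 1)) ≠ 1 := by
    intro h; simpa using congrArg Fin.val h
  set s : Perm (Fin (2 * (m + 1) + 1)) := swap 0 1 with hs
  have ss : ∀ x, s (s x) = x := fun x => by simp [hs]
  set f : Perm (Fin (2 * (m + 1) + 1)) → ℝ := fun σ =>
    ((sign σ : ℤ) : ℝ) * ∏ i, a (σ (fstPos i)) (σ (sndPos i)) with hf
  set G : Fin (m + 1) → Perm (Fin (2 * (m + 1) + 1)) → ℝ := fun i σ =>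
    if σ (fstPos i) = 0 ∧ σ (sndPos i) = 1 then
      ((sign σ : ℤ) : ℝ) * ∏ k, (if k = i then 1 else a (σ (fstPos k)) (σ (sndPos k))) else 0
    with hG
  -- The swap of 0 and 1 changes a factor only if that factor pairs these two labels with each
  -- other.
  have hsa : ∀ x y, x ≠ y → ¬ (x = 0 ∧ y = 1) → ¬ (x = 1 ∧ y = 0) → a (s x) (s y) = a x y := by
    intro x y hxy h h'
    by_cases hx0 : x = 0
    · have : y ≠ 0 := fun e => hxy (hx0.trans e.symm)
      have h1 : y ≠ 1 := fun e => h ⟨hx0, e⟩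
      simp [hs, hx0, swap_apply_of_ne_of_ne this h1, hrow y this h1]
    by_cases hx1 : x = 1
    · have : y ≠ 1 := fun e => hxy (hx1.trans e.symm)
      have h1 : y ≠ 0 := fun e => h' ⟨hx1, e⟩
      simp [hs, hx1, swap_apply_of_ne_of_ne h1 this, hrow y h1 this]
    rw [hs, swap_apply_of_ne_of_ne hx0 hx1]
    by_cases hy0 : y = 0
    · simp [hy0, hcol x hx0 hx1]
    by_cases hy1 : y = 1
    · simp [hy1, hcol x hx0 hx1]
    rw [swap_apply_of_ne_of_ne hy0 hy1]
  have hsgn : ∀ σ, ((sign (s * σ) : ℤ) : ℝ) = - ((sign σ : ℤ) : ℝ) := by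
    intro σ; simp [hs, Perm.sign_mul, sign_swap h01]
  have hpair : ∀ (σ : Perm (Fin (2 * (m + 1) + 1))) i, σ (fstPos i) ≠ σ (sndPos i) :=
    fun σ i h => fstPos_ne_sndPos i i (σ.injective h)
  -- If 0 and 1 form the `i`-th pair, then `σ` and `s * σ` have opposite signs and differ in that
  -- factor alone, so `a 0 1 - a 1 0 = 1` can be taken out.
  have step : ∀ σ i, σ (fstPos i) = 0 → σ (sndPos i) = 1 →
      f σ + f (s * σ) = ∑ j, (G j σ + G j (s * σ)) := by
    intro σ i hi hi'
    have hne : ∀ k, k ≠ i → (σ (fstPos k) ≠ 0 ∧ σ (fstPos k) ≠ 1) ∧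
        (σ (sndPos k) ≠ 0 ∧ σ (sndPos k) ≠ 1) := by
      intro k hk
      rw [← hi, ← hi']
      simp only [ne_eq, σ.injective.eq_iff, fstPos_injective.eq_iff, sndPos_injective.eq_iff, hk,
        fstPos_ne_sndPos, (fstPos_ne_sndPos _ _).symm, not_false_eq_true, and_self]
    have hprod : ∏ k, (if k = i then 1 else a ((s * σ) (fstPos k)) ((s * σ) (sndPos k))) =
        ∏ k, (if k = i then 1 else a (σ (fstPos k)) (σ (sndPos k))) := by
      refine Finset.prod_congr rfl fun k _ => ?_
      split_ifs with hk
      · rfl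
      · obtain ⟨⟨h1, h2⟩, h3, h4⟩ := hne k hk
        exact hsa _ _ (hpair σ k) (fun h => h1 h.1) fun h => h2 h.1
    have hsplit : ∀ τ : Perm (Fin (2 * (m + 1) + 1)),
        ∏ k, a (τ (fstPos k)) (τ (sndPos k)) = a (τ (fstPos i)) (τ (sndPos i)) *
        ∏ k, (if k = i then 1 else a (τ (fstPos k)) (τ (sndPos k))) := by
      intro τ
      rw [← Finset.mul_prod_erase _ _ (Finset.mem_univ i)]
      congr 1
      rw [← Finset.mul_prod_erase Finset.univ (fun k => if k = i then 1 else _)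
        (Finset.mem_univ i), if_pos rfl, one_mul]
      exact Finset.prod_congr rfl fun k hk => by rw [if_neg (Finset.ne_of_mem_erase hk)]
    have hr : ∑ j, (G j σ + G j (s * σ)) = G i σ := by
      rw [Finset.sum_eq_single i]
      · have : G i (s * σ) = 0 := if_neg (by simp [hi, hi', hs, h01.symm])
        rw [this, add_zero]
      · intro j _ hj
        obtain ⟨⟨h1, h2⟩, h3, h4⟩ := hne j hj
        have e1 : G j σ = 0 := if_neg fun h => h1 h.1
        have e2 : G j (s * σ) = 0 := if_neg fun h => h2 (by
          have := congrArg s h.1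
          simpa [ss, hs] using this)
        rw [e1, e2, add_zero]
      · simp
    rw [hr]
    simp only [Perm.mul_apply] at hprod
    simp only [hf, hG, hsplit, hsgn, hi, hi', and_self, if_true, Perm.mul_apply, hprod]
    rw [show s 0 = 1 by simp [hs], show s 1 = 0 by simp [hs]]
    linear_combination ((sign σ : ℤ) : ℝ) *
      (∏ k, (if k = i then 1 else a (σ (fstPos k)) (σ (sndPos k)))) * h₁
  have hssσ : ∀ σ, s * (s * σ) = σ := fun σ => by ext x; simp [Perm.mul_apply, ss]
  have point : ∀ σ, f σ + f (s * σ) = ∑ j, (G j σ + G j (s * σ)) := by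
    intro σ
    by_cases h : ∃ i, σ (fstPos i) = 0 ∧ σ (sndPos i) = 1
    · obtain ⟨i, hi, hi'⟩ := h
      exact step σ i hi hi'
    by_cases h' : ∃ i, σ (fstPos i) = 1 ∧ σ (sndPos i) = 0
    · obtain ⟨i, hi, hi'⟩ := h'
      have := step (s * σ) i (by simp [hi, hs]) (by simp [hi', hs])
      rw [hssσ] at this
      rw [add_comm, this]
      exact Finset.sum_congr rfl fun _ _ => add_comm _ _
    -- Here 0 and 1 are not paired together, and the two words cancel.
    push Not at h h'
    have hfs : f (s * σ) = - f σ := by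
      simp only [hf, hsgn, neg_mul]
      congr 2
      exact Finset.prod_congr rfl fun k _ => hsa _ _ (hpair σ k) (fun e => h k e.1 e.2)
        (fun e => h' k e.1 e.2)
    rw [hfs, add_neg_cancel]
    refine (Finset.sum_eq_zero fun j _ => ?_).symm
    have e1 : G j σ = 0 := if_neg fun e => h j e.1 e.2
    have e2 : G j (s * σ) = 0 := if_neg fun e => h' j
      (by have := congrArg s e.1; simpa [ss, hs] using this)
      (by have := congrArg s e.2; simpa [ss, hs] using this)
    rw [e1, e2, add_zero]
  -- Summation over all `σ` counts each side twice; the `m + 1` possible places of the pair give the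
  -- factor in the claim.
  have total : ∑ σ, (f σ + f (s * σ)) = ∑ j, ∑ σ, (G j σ + G j (s * σ)) := by
    rw [Finset.sum_comm]
    exact Finset.sum_congr rfl fun σ _ => point σ
  have hshift : ∀ F : Perm (Fin (2 * (m + 1) + 1)) → ℝ, ∑ σ, F (s * σ) = ∑ σ, F σ :=
    fun F => Equiv.sum_comp (Equiv.mulLeft s) F
  simp only [Finset.sum_add_distrib, hshift] at total
  have hGi : ∀ i, ∑ σ, G i σ = pairSum (m := m) fun u v => a u.succ.succ v.succ.succ :=
    fun i => sum_with_fixed_pair a i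
  simp only [hGi, Finset.sum_const, Finset.card_univ, Fintype.card_fin, nsmul_eq_mul] at total
  have hS : pairSum a = ∑ σ, f σ := rfl
  rw [hS]
  push_cast at total
  linarith

/-! ### Averaging over independent coordinates -/

/-- This is Fubini for a product measure: the coordinates `k i`, `l i` are all distinct, so the sum
factors over `i`, and the unused coordinates have total mass 1. -/
theorem sum_pi_weight_mul {κ ι : Type*} [Fintype κ] [DecidableEq κ] [Fintype ι] [DecidableEq ι]
    (wt : κ → Bool → ℝ) (hwt : ∀ p, ∑ b, wt p b = 1) (k l : ι → κ)
    (hkl : Function.Injective (Sum.elim k l)) (F : ι → Bool → Bool → ℝ) :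
    ∑ f : κ → Bool, (∏ p, wt p (f p)) * ∏ i, F i (f (k i)) (f (l i)) =
      ∏ i, ∑ b, ∑ c, wt (k i) b * wt (l i) c * F i b c := by
  classical
  let e : (ι ⊕ ι) ⊕ {x // x ∉ Set.range (Sum.elim k l)} ≃ κ :=
    ((Equiv.ofInjective _ hkl).sumCongr (Equiv.refl _)).trans
      (Equiv.sumCompl fun x => x ∈ Set.range (Sum.elim k l))
  have e1 : ∀ i, e (Sum.inl (Sum.inl i)) = k i := fun i => rfl
  have e2 : ∀ i, e (Sum.inl (Sum.inr i)) = l i := fun i => rfl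
  let E : ((ι → Bool) × (ι → Bool)) × ({x // x ∉ Set.range (Sum.elim k l)} → Bool) ≃ (κ → Bool) :=
    (((Equiv.sumArrowEquivProdArrow ι ι Bool).symm.prodCongr (Equiv.refl _)).trans
      (Equiv.sumArrowEquivProdArrow _ _ Bool).symm).trans (e.arrowCongr (Equiv.refl Bool))
  have hE1 : ∀ x i, E x (k i) = x.1.1 i := fun x i => by
    rw [← e1]; simp [E, Equiv.arrowCongr]; rfl
  have hE2 : ∀ x i, E x (l i) = x.1.2 i := fun x i => by
    rw [← e2]; simp [E, Equiv.arrowCongr]; rfl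
  have hE3 : ∀ x i, E x (e (Sum.inr i)) = x.2 i := fun x i => by
    simp [E, Equiv.arrowCongr]; rfl
  rw [← Equiv.sum_comp E, Fintype.sum_prod_type, Fintype.sum_prod_type]
  have hw : ∀ x, ∏ p, wt p (E x p) = (∏ i, wt (k i) (x.1.1 i) * wt (l i) (x.1.2 i)) *
      ∏ i, wt (e (Sum.inr i)) (x.2 i) := by
    intro x
    rw [← Equiv.prod_comp e, Fintype.prod_sum_type, Fintype.prod_sum_type]
    simp only [e1, e2, hE1, hE2, hE3, Finset.prod_mul_distrib]
  simp only [hw, hE1, hE2]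
  have hrest : ∑ f : {x // x ∉ Set.range (Sum.elim k l)} → Bool,
      ∏ i, wt (e (Sum.inr i)) (f i) = 1 := by
    rw [← Fintype.prod_sum]
    exact Finset.prod_eq_one fun i _ => hwt _
  have : ∀ (x y : ι → Bool), ∑ f : {x // x ∉ Set.range (Sum.elim k l)} → Bool,
      (∏ i, wt (k i) (x i) * wt (l i) (y i)) * (∏ i, wt (e (Sum.inr i)) (f i)) *
        ∏ i, F i (x i) (y i) = ∏ i, wt (k i) (x i) * wt (l i) (y i) * F i (x i) (y i) := by
    intro x y
    rw [← Finset.sum_mul, ← Finset.mul_sum, hrest, mul_one]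
    simp only [Finset.prod_mul_distrib]
  simp only [this]
  have h2 : ∀ x : ι → Bool, ∑ y : ι → Bool, ∏ i, wt (k i) (x i) * wt (l i) (y i) * F i (x i) (y i) =
      ∏ i, ∑ c, wt (k i) (x i) * wt (l i) c * F i (x i) c := fun x =>
    (Fintype.prod_sum fun i c => wt (k i) (x i) * wt (l i) c * F i (x i) c).symm
  simp only [h2]
  exact (Fintype.prod_sum fun i b => ∑ c, wt (k i) b * wt (l i) c * F i b c).symm

/-- The average of a `pairSum` whose entries depend on independent coordinates. -/
theorem sum_weight_mul_pairSum {κ : Type*} [Fintype κ] [DecidableEq κ] {m : ℕ}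
    (wt : κ → Bool → ℝ) (hwt : ∀ p, ∑ b, wt p b = 1) (k : Fin (2 * m + 1) → κ)
    (hk : Function.Injective k) (a : Fin (2 * m + 1) → Fin (2 * m + 1) → Bool → Bool → ℝ) :
    ∑ f : κ → Bool, (∏ p, wt p (f p)) * pairSum (fun u v => a u v (f (k u)) (f (k v))) =
      pairSum fun u v => ∑ b, ∑ c, wt (k u) b * wt (k v) c * a u v b c := by
  simp only [pairSum, Finset.mul_sum]
  rw [Finset.sum_comm]
  refine Finset.sum_congr rfl fun σ _ => ?_
  rw [← sum_pi_weight_mul wt hwt (fun i => k (σ (fstPos i))) (fun i => k (σ (sndPos i))) _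
    fun i => a (σ (fstPos i)) (σ (sndPos i)), Finset.mul_sum]
  · exact Finset.sum_congr rfl fun f _ => by ring
  -- The letters of a word are distinct, so no coordinate enters two factors.
  · rintro (i | i) (j | j) h <;>
      simp only [Sum.elim_inl, Sum.elim_inr, hk.eq_iff, σ.injective.eq_iff,
        fstPos_injective.eq_iff, sndPos_injective.eq_iff, fstPos_ne_sndPos,
        (fstPos_ne_sndPos _ _).symm] at h
    · rw [h]
    · rw [h]

/-! ### Lifted configurations -/

/-- The positions of the tokens on the universal cover of the ring, in clockwise order. Tokens at
the same processor are allowed. -/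
structure IsCyclic (N : ℕ) {m : ℕ} (z : Fin (2 * m + 1) → ℤ) : Prop where
  mono : Monotone z
  last_le : z (Fin.last (2 * m)) ≤ z 0 + N

/-- The tokens are at pairwise distinct processors. -/
structure IsStrictCyclic (N : ℕ) {m : ℕ} (z : Fin (2 * m + 1) → ℤ) : Prop where
  strictMono : StrictMono z
  last_lt : z (Fin.last (2 * m)) < z 0 + N

/-- Renumber the tokens, starting with the second one. -/
def rot (N : ℕ) {m : ℕ} (z : Fin (2 * m + 1) → ℤ) (i : Fin (2 * m + 1)) : ℤ :=
  z (finRotate _ i) + if i = Fin.last (2 * m) then (N : ℤ) else 0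

/-- The clockwise distance from the token `u` to the token `v`. -/
def clockDist (N : ℕ) {m : ℕ} (z : Fin (2 * m + 1) → ℤ) (u v : Fin (2 * m + 1)) : ℝ :=
  (z v : ℝ) - z u + if u < v then 0 else (N : ℝ)

/-- The normalized alternating sum of the products of the values `P (clockDist N z u v)`. -/
noncomputable def pfaff (P : ℝ → ℝ) (N : ℕ) {m : ℕ} (z : Fin (2 * m + 1) → ℤ) : ℝ :=
  pairSum (fun u v => P (clockDist N z u v)) / (m.factorial : ℝ)

/-- The processors that hold an odd number of tokens. -/
def oddSet (N : ℕ) [NeZero N] {m : ℕ} (z : Fin (2 * m + 1) → ℤ) : Finset (ZMod N) :=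
  Finset.univ.filter fun p => Odd (∑ u, if (z u : ZMod N) = p then 1 else 0)

theorem rot_last (N : ℕ) {m : ℕ} (z : Fin (2 * m + 1) → ℤ) :
    rot N z (Fin.last (2 * m)) = z 0 + N := by
  simp [rot]

theorem rot_of_lt (N : ℕ) {m : ℕ} (z : Fin (2 * m + 1) → ℤ) {k : ℕ} (hk : k < 2 * m) :
    rot N z ⟨k, by omega⟩ = z ⟨k + 1, by omega⟩ := by
  rw [rot, finRotate_of_lt hk, if_neg, add_zero]
  intro h
  have := congrArg Fin.val h
  simp at this; omega

theorem IsCyclic.rot {N m : ℕ} {z : Fin (2 * m + 1) → ℤ} (hz : IsCyclic N z) :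
    IsCyclic N (rot N z) := by
  have hle : ∀ i, z i ≤ z 0 + N := fun i => (hz.mono (Fin.le_last i)).trans hz.last_le
  constructor
  · intro i j hij
    rcases Nat.lt_or_ge j (2 * m) with hj | hj
    · have hi : (i : ℕ) < 2 * m := lt_of_le_of_lt hij hj
      have := rot_of_lt N z hi
      have h2 := rot_of_lt N z hj
      simp only [Fin.eta] at this h2
      rw [this, h2]
      exact hz.mono (Nat.succ_le_succ hij)
    · obtain rfl : j = Fin.last (2 * m) := by ext; simp; omega
      rw [rot_last]
      rcases Nat.lt_or_ge i (2 * m) with hi | hi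
      · have := rot_of_lt N z hi
        simp only [Fin.eta] at this
        rw [this]
        exact hle _
      · obtain rfl : i = Fin.last (2 * m) := by ext; simp; omega
        rw [rot_last]
  · rw [rot_last]
    rcases Nat.eq_zero_or_pos m with rfl | hm
    · have := rot_last N z
      have h0 : (0 : Fin (2 * 0 + 1)) = Fin.last (2 * 0) := rfl
      rw [h0, this]
      simp
    · have := rot_of_lt N z (k := 0) (by omega)
      have h0 : (0 : Fin (2 * m + 1)) = ⟨0, by omega⟩ := rfl
      rw [h0, this]
      gcongr
      apply hz.mono
      simp

/-- The turn `N` added to the token that becomes last compensates exactly for its changed place in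
the order. -/
theorem clockDist_rot (N : ℕ) {m : ℕ} (z : Fin (2 * m + 1) → ℤ) (u v : Fin (2 * m + 1)) :
    clockDist N (rot N z) u v = clockDist N z (finRotate _ u) (finRotate _ v) := by
  unfold clockDist rot
  rcases Nat.lt_or_ge u (2 * m) with hu | hu <;> rcases Nat.lt_or_ge v (2 * m) with hv | hv
  · have h1 : finRotate _ u = (⟨u + 1, by omega⟩ : Fin (2 * m + 1)) := finRotate_of_lt hu
    have h2 : finRotate _ v = (⟨v + 1, by omega⟩ : Fin (2 * m + 1)) := finRotate_of_lt hv
    have h3 : u ≠ Fin.last (2 * m) := by rintro rfl; simp at hu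
    have h4 : v ≠ Fin.last (2 * m) := by rintro rfl; simp at hv
    simp [h1, h2, h3, h4]
  · obtain rfl : v = Fin.last (2 * m) := by ext; simp; omega
    have h1 : finRotate _ u = (⟨u + 1, by omega⟩ : Fin (2 * m + 1)) := finRotate_of_lt hu
    have h3 : u ≠ Fin.last (2 * m) := by rintro rfl; simp at hu
    have h5 : u < Fin.last (2 * m) := hu
    simp [h1, h3, h5]
    ring
  · obtain rfl : u = Fin.last (2 * m) := by ext; simp; omega
    have h2 : finRotate _ v = (⟨v + 1, by omega⟩ : Fin (2 * m + 1)) := finRotate_of_lt hv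
    have h4 : v ≠ Fin.last (2 * m) := by rintro rfl; simp at hv
    have h5 : ¬ Fin.last (2 * m) < v := by simp [Fin.le_last]
    have h6 : (0 : Fin (2 * m + 1)) < ⟨v + 1, by omega⟩ := by simp [Fin.lt_def]
    simp [h2, h4, h5, h6]
    ring
  · obtain rfl : v = Fin.last (2 * m) := by ext; simp; omega
    obtain rfl : u = Fin.last (2 * m) := by ext; simp; omega
    simp

/-- A cyclic shift of the odd number `2 * m + 1` of labels is an even permutation. -/
theorem pfaff_rot (P : ℝ → ℝ) (N : ℕ) {m : ℕ} (z : Fin (2 * m + 1) → ℤ) :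
    pfaff P N (rot N z) = pfaff P N z := by
  unfold pfaff
  simp only [clockDist_rot]
  rw [pairSum_reindex (fun u v => P (clockDist N z u v)) (finRotate _)]
  rw [sign_finRotate]
  simp

theorem oddSet_rot (N : ℕ) [NeZero N] {m : ℕ} (z : Fin (2 * m + 1) → ℤ) :
    oddSet N (rot N z) = oddSet N z := by
  have h : ∀ u, ((rot N z u : ℤ) : ZMod N) = (z (finRotate _ u) : ZMod N) := by
    intro u
    unfold rot
    split_ifs <;> simp
  unfold oddSet
  simp only [h]
  congr 1
  ext p
  rw [Equiv.sum_comp (finRotate _) fun u => if (z u : ZMod N) = p then 1 else 0]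

/-- If two consecutive tokens are at the same processor, then they can be removed. -/
theorem IsCyclic.exists_remove {N : ℕ} [NeZero N] (k : ℕ) : ∀ {m : ℕ} {z : Fin (2 * m + 1) → ℤ},
    IsCyclic N z → (hk : k < 2 * m + 1) → Herman.rot N z ⟨k, hk⟩ = z ⟨k, hk⟩ →
    ∃ m' < m, ∃ z' : Fin (2 * m' + 1) → ℤ, IsCyclic N z' ∧ oddSet N z' = oddSet N z ∧
      ∀ P : ℝ → ℝ, P 0 - P N = 1 → pfaff P N z' = pfaff P N z := by
  induction k with
  | zero =>
    intro m z hz hk h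
    -- A lone token cannot collide with itself, since its next copy on the cover is `N > 0` further
    -- on.
    rcases m with _ | m
    · have := rot_last N z
      have h0 : (⟨0, hk⟩ : Fin (2 * 0 + 1)) = Fin.last (2 * 0) := rfl
      have hN := NeZero.ne N
      rw [h0, this] at h
      have h1 : (0 : Fin (2 * 0 + 1)) = Fin.last (2 * 0) := rfl
      rw [h1] at h
      omega
    · have h10 : z 1 = z 0 := by
        rw [rot_of_lt N z (by omega)] at h
        exact h
      refine ⟨m, by omega, fun u => z u.succ.succ, ⟨?_, ?_⟩, ?_, ?_⟩
      · intro i j hij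
        apply hz.mono
        simpa using hij
      · refine hz.last_le.trans ?_
        gcongr
        apply hz.mono
        simp
      · unfold oddSet
        congr 1
        ext p
        have : ∀ f : Fin (2 * (m + 1) + 1) → ℕ,
            ∑ u, f u = f 0 + (f 1 + ∑ u : Fin (2 * m + 1), f u.succ.succ) := by
          intro f
          exact (Fin.sum_univ_succ f).trans (congrArg _
            (Fin.sum_univ_succ fun i : Fin (2 * m + 1 + 1) => f i.succ))
        -- The two deleted tokens share a processor, so every parity is unchanged.
        rw [this fun u => if (z u : ZMod N) = p then 1 else 0, h10]
        simp only [Nat.odd_add, ← Nat.not_odd_iff_even]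
        tauto
      · intro P hP
        unfold pfaff
        -- The factor `m + 1` turns `m!` into `(m + 1)!`. The distance from token 0 to token 1 is 0,
        -- and the distance back is `N`.
        rw [pairSum_remove (fun u v => P (clockDist N z u v)), Nat.factorial_succ]
        · simp only [clockDist, Fin.succ_lt_succ_iff]
          push_cast
          field_simp
        · intro x h0 h1
          have h2 : 0 < x := Fin.pos_iff_ne_zero.2 h0
          have h3 : 1 < x := by
            have a0 : (x : ℕ) ≠ 0 := fun e => h0 (Fin.ext e)
            have a1 : (x : ℕ) ≠ 1 := fun e => h1 (Fin.ext e)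
            show 1 < (x : ℕ)
            omega
          simp [clockDist, h10, h2, h3]
        · intro x h0 h1
          have h3 : 1 < x := by
            have a0 : (x : ℕ) ≠ 0 := fun e => h0 (Fin.ext e)
            have a1 : (x : ℕ) ≠ 1 := fun e => h1 (Fin.ext e)
            show 1 < (x : ℕ)
            omega
          simp [clockDist, h10, h3.not_gt]
        · simpa [clockDist, h10, Fin.lt_def] using hP
  | succ k ih =>
    intro m z hz hk h
    -- Renumbering moves the collision from index `k + 1` to index `k`. The index `2 * m` covers the
    -- collision of the last token with the first one, one turn later.
    have h' : Herman.rot N (Herman.rot N z) ⟨k, by omega⟩ = Herman.rot N z ⟨k, by omega⟩ := by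
      rw [rot_of_lt N (Herman.rot N z) (by omega), h, rot_of_lt N z (by omega)]
    obtain ⟨m', hm', z', h1, h2, h3⟩ := ih hz.rot (by omega) h'
    refine ⟨m', hm', z', h1, h2.trans (oddSet_rot N z), fun P hP => (h3 P hP).trans ?_⟩
    exact pfaff_rot P N z

theorem IsCyclic.isStrictCyclic {N : ℕ} {m : ℕ} {z : Fin (2 * m + 1) → ℤ} (hz : IsCyclic N z)
    (h : ∀ k, Herman.rot N z k ≠ z k) : IsStrictCyclic N z := by
  constructor
  · refine Fin.strictMono_iff_lt_succ.2 fun i => lt_of_le_of_ne (hz.mono (Fin.castSucc_le_succ i)) ?_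
    have := h i.castSucc
    have h2 := rot_of_lt N z i.isLt
    rw [show (⟨i, by omega⟩ : Fin (2 * m + 1)) = i.castSucc from rfl] at h2
    rw [h2] at this
    exact this.symm
  · have := h (Fin.last _)
    rw [rot_last] at this
    exact lt_of_le_of_ne hz.last_le this.symm

theorem IsStrictCyclic.isCyclic {N : ℕ} {m : ℕ} {z : Fin (2 * m + 1) → ℤ}
    (hz : IsStrictCyclic N z) : IsCyclic N z :=
  ⟨hz.strictMono.monotone, hz.last_lt.le⟩

theorem IsStrictCyclic.injective {N : ℕ} {m : ℕ} {z : Fin (2 * m + 1) → ℤ}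
    (hz : IsStrictCyclic N z) : Function.Injective fun u => (z u : ZMod N) := by
  have key : ∀ u v, z u ≤ z v → (z u : ZMod N) = z v → z u = z v := by
    intro u v huv h
    rw [ZMod.intCast_eq_intCast_iff_dvd_sub] at h
    have h1 := hz.isCyclic.mono (Fin.le_last v)
    have h2 := hz.isCyclic.mono (Fin.zero_le u)
    have h3 := hz.last_lt
    have := Int.eq_zero_of_dvd_of_nonneg_of_lt (by omega) (by omega) h
    omega
  intro u v h
  apply hz.strictMono.injective
  rcases le_total (z u) (z v) with h1 | h1
  · exact key u v h1 h
  · exact (key v u h1 h.symm).symm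

theorem IsStrictCyclic.mem_oddSet {N : ℕ} [NeZero N] {m : ℕ} {z : Fin (2 * m + 1) → ℤ}
    (hz : IsStrictCyclic N z) (p : ZMod N) : p ∈ oddSet N z ↔ ∃ u, (z u : ZMod N) = p := by
  unfold oddSet
  simp only [Finset.mem_filter, Finset.mem_univ, true_and]
  constructor
  · intro h
    by_contra! hc
    simp [hc] at h
  · rintro ⟨u, rfl⟩
    rw [Finset.sum_eq_single u]
    · simp
    · intro v _ hv
      exact if_neg fun h => hv (hz.injective h)
    · simp

theorem IsStrictCyclic.oddSet_eq_image {N : ℕ} [NeZero N] {m : ℕ} {z : Fin (2 * m + 1) → ℤ}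
    (hz : IsStrictCyclic N z) : oddSet N z = Finset.univ.image fun u => (z u : ZMod N) := by
  ext p
  simp [hz.mem_oddSet]

theorem IsStrictCyclic.card_oddSet {N : ℕ} [NeZero N] {m : ℕ} {z : Fin (2 * m + 1) → ℤ}
    (hz : IsStrictCyclic N z) : (oddSet N z).card = 2 * m + 1 := by
  rw [hz.oddSet_eq_image, Finset.card_image_of_injective _ hz.injective]
  simp

/-! ### One synchronous step on the universal cover -/

/-- The displacement that belongs to a decision. -/
def shift (b : Bool) : ℤ := if b then 1 else 0

/-- Integer gaps are at least 1 and shrink by at most 1 in a step, so tokens can meet but never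
overtake. -/
theorem IsStrictCyclic.isCyclic_add {N : ℕ} {m : ℕ} {z : Fin (2 * m + 1) → ℤ}
    (hz : IsStrictCyclic N z) (b : Fin (2 * m + 1) → Bool) :
    IsCyclic N fun u => z u + shift (b u) := by
  have hb : ∀ u, 0 ≤ shift (b u) ∧ shift (b u) ≤ 1 := by
    intro u; unfold shift; split_ifs <;> simp
  constructor
  · intro i j hij
    rcases hij.eq_or_lt with rfl | hij
    · exact le_rfl
    · have := hz.strictMono hij
      have h1 := hb i
      have h2 := hb j
      show z i + shift (b i) ≤ z j + shift (b j)
      omega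
  · have := hz.last_lt
    have h1 := hb 0
    have h2 := hb (Fin.last _)
    show z (Fin.last _) + shift (b (Fin.last _)) ≤ z 0 + shift (b 0) + N
    omega

/-- Annihilation in pairs means that only parities matter: the lifted tokens may stay doubled up,
and `oddSet` forgets them. -/
theorem IsStrictCyclic.step_oddSet {N : ℕ} [NeZero N] {m : ℕ} {z : Fin (2 * m + 1) → ℤ}
    (hz : IsStrictCyclic N z) (pass : ZMod N → Bool) :
    step (oddSet N z) pass = oddSet N fun u => z u + shift (pass (z u)) := by
  ext p
  have hsplit : ∀ u, (if ((z u + shift (pass (z u)) : ℤ) : ZMod N) = p then 1 else 0) =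
      (if (z u : ZMod N) = p ∧ pass p = false then 1 else 0) +
        (if (z u : ZMod N) = p - 1 ∧ pass (p - 1) = true then 1 else 0 : ℕ) := by
    intro u
    -- For `N = 1` the processor `p - 1` is `p` itself, so the two sources of tokens must be told
    -- apart by the coin alone.
    by_cases hN1 : N = 1
    · subst hN1
      have e : ∀ x y : ZMod 1, x = y := fun x y => Subsingleton.elim _ _
      rw [e (p - 1) p, e (z u) p]
      cases pass p <;> simp [e _ p]
    cases hp : pass (z u)
    · simp only [shift, Bool.false_eq_true, if_false, add_zero]
      by_cases h1 : (z u : ZMod N) = p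
      · have : p ≠ p - 1 := by
          intro e
          have h10 : (1 : ZMod N) = 0 := by linear_combination e
          have : Fact (1 < N) := ⟨by have := NeZero.ne N; omega⟩
          exact one_ne_zero h10
        subst h1
        simp [hp, this]
      · simp only [h1, false_and, if_false, zero_add]
        rw [if_neg]
        rintro ⟨h2, h3⟩
        rw [← h2, hp] at h3
        simp at h3
    · simp only [shift, if_true, Int.cast_add, Int.cast_one, ← eq_sub_iff_add_eq]
      have h1 : ¬ ((z u : ZMod N) = p ∧ pass p = false) := by
        rintro ⟨h2, h3⟩
        rw [← h2, hp] at h3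
        simp at h3
      rw [if_neg h1, zero_add]
      congr 1
      refine propext ⟨fun h => ⟨h, by rw [← h, hp]⟩, fun h => h.1⟩
  have hcount : ∀ (q : ZMod N) (c : Bool),
      (∑ u, if (z u : ZMod N) = q ∧ pass q = c then 1 else 0) =
        if q ∈ oddSet N z ∧ pass q = c then 1 else 0 := by
    intro q c
    by_cases hq : pass q = c
    · simp only [hq, and_true]
      by_cases hm : q ∈ oddSet N z
      · rw [if_pos hm]
        obtain ⟨u, rfl⟩ := (hz.mem_oddSet q).1 hm
        rw [Finset.sum_eq_single u]
        · simp
        · intro v _ hv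
          exact if_neg fun h => hv (hz.injective h)
        · simp
      · rw [if_neg hm]
        refine Finset.sum_eq_zero fun u _ => if_neg fun h => hm ((hz.mem_oddSet q).2 ⟨u, h⟩)
    · simp [hq]
  have hl : p ∈ step (oddSet N z) pass ↔
      Xor (p ∈ oddSet N z ∧ pass p = false) (p - 1 ∈ oddSet N z ∧ pass (p - 1) = true) := by
    unfold step
    rw [Finset.mem_symmDiff]
    have : p ∈ ((oddSet N z).filter fun p => pass p = true).image (fun p => p + 1) ↔
        (p - 1 ∈ oddSet N z ∧ pass (p - 1) = true) := by
      rw [Finset.mem_image]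
      constructor
      · rintro ⟨q, hq, rfl⟩
        simpa using hq
      · intro hq
        exact ⟨p - 1, by simpa using hq, by ring⟩
    rw [this, Finset.mem_filter]
    rfl
  have hr : (p ∈ oddSet N fun u => z u + shift (pass (z u))) ↔
      Odd ((if p ∈ oddSet N z ∧ pass p = false then 1 else 0) +
        if p - 1 ∈ oddSet N z ∧ pass (p - 1) = true then 1 else 0 : ℕ) := by
    rw [← hcount, ← hcount, ← Finset.sum_add_distrib]
    simp only [← hsplit]
    rw [oddSet, Finset.mem_filter]
    simp only [Finset.mem_univ, true_and]
  rw [hl, hr]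
  by_cases hA : p ∈ oddSet N z ∧ pass p = false <;>
    by_cases hB : p - 1 ∈ oddSet N z ∧ pass (p - 1) = true <;>
    simp only [Xor, hA, hB] <;> simp

/-! ### The absorption probabilities of the difference of two tokens -/

/-- The decaying part of the probability `hit` below, with normalized distance `y`. -/
noncomputable def transient (N : ℕ) (r : ℝ) (t : ℕ) (y : ℝ) : ℝ :=
  (-1 / (N : ℝ)) * ∑ j ∈ Finset.Icc 1 (N - 1), g j y (1 / N) * h r j (1 / N) ^ t

/-- The probability that the clockwise distance of two tokens, initially `x`, has become `0`
after `t` steps. -/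
noncomputable def hit (N : ℕ) (r : ℝ) (t : ℕ) (x : ℝ) : ℝ :=
  (1 - x / N) + transient N r t (x / N)

theorem hit_zero (N : ℕ) (r : ℝ) (t : ℕ) : hit N r t 0 = 1 := by
  simp [hit, transient, g]

theorem hit_self (N : ℕ) [NeZero N] (r : ℝ) (t : ℕ) : hit N r t N = 0 := by
  have : (N : ℝ) ≠ 0 := Nat.cast_ne_zero.2 (NeZero.ne N)
  simp [hit, transient, g, Real.sin_nat_mul_pi]

/-- The difference of two tokens moves by 1 in either direction with probability `r * (1 - r)` each.
Affine functions are invariant under this walk, and the sine in `g j` is an eigenfunction with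
eigenvalue `h r j`. The identity is purely algebraic, hence free of boundary conditions. -/
theorem hit_add_one_add_hit_sub_one (N : ℕ) [NeZero N] (r : ℝ) (t : ℕ) (x : ℝ) :
    r * (1 - r) * hit N r t (x + 1) + (1 - 2 * (r * (1 - r))) * hit N r t x +
      r * (1 - r) * hit N r t (x - 1) = hit N r (t + 1) x := by
  have hN : (N : ℝ) ≠ 0 := Nat.cast_ne_zero.2 (NeZero.ne N)
  have hg : ∀ j : ℕ, r * (1 - r) * g j ((x + 1) / N) (1 / N) +
      (1 - 2 * (r * (1 - r))) * g j (x / N) (1 / N) + r * (1 - r) * g j ((x - 1) / N) (1 / N) =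
      g j (x / N) (1 / N) * h r j (1 / N) := by
    intro j
    unfold g h
    rw [show (j : ℝ) * Real.pi * ((x + 1) / N) = j * Real.pi * (x / N) + j * Real.pi * (1 / N) by
      ring, show (j : ℝ) * Real.pi * ((x - 1) / N) = j * Real.pi * (x / N) - j * Real.pi * (1 / N)
      by ring, Real.sin_add, Real.sin_sub]
    ring
  have hsum : r * (1 - r) * (∑ j ∈ Finset.Icc 1 (N - 1), g j ((x + 1) / N) (1 / N) *
      h r j (1 / N) ^ t) + (1 - 2 * (r * (1 - r))) * (∑ j ∈ Finset.Icc 1 (N - 1),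
      g j (x / N) (1 / N) * h r j (1 / N) ^ t) + r * (1 - r) * (∑ j ∈ Finset.Icc 1 (N - 1),
      g j ((x - 1) / N) (1 / N) * h r j (1 / N) ^ t) =
      ∑ j ∈ Finset.Icc 1 (N - 1), g j (x / N) (1 / N) * h r j (1 / N) ^ (t + 1) := by
    simp only [Finset.mul_sum, ← Finset.sum_add_distrib]
    refine Finset.sum_congr rfl fun j _ => ?_
    linear_combination h r j (1 / N) ^ t * hg j
  unfold hit transient
  rw [← hsum]
  ring

/-! ### Trigonometric sums: initial values and decay rates -/

theorem two_mul_sin_mul_sum_cos (φ : ℝ) (n : ℕ) :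
    2 * Real.sin (φ / 2) * ∑ j ∈ Finset.Icc 1 n, Real.cos (j * φ) =
      Real.sin (n * φ + φ / 2) - Real.sin (φ / 2) := by
  induction n with
  | zero => simp
  | succ n ih =>
    rw [Finset.sum_Icc_succ_top (by omega), mul_add, ih]
    have e : (n : ℝ) * φ + φ / 2 = ((n + 1 : ℕ) : ℝ) * φ - φ / 2 := by push_cast; ring
    rw [e, Real.sin_add, Real.sin_sub]
    ring

theorem sin_half_pos {N x : ℕ} (h0 : 0 < x) (hx : x < 2 * N) :
    0 < Real.sin (Real.pi * (x / N) / 2) := by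
  have hN : (0 : ℝ) < N := by
    have : 0 < N := by omega
    exact_mod_cast this
  have hx' : (x : ℝ) / N < 2 := by
    rw [div_lt_iff₀ hN]
    exact_mod_cast hx
  have hx0 : 0 < (x : ℝ) / N := div_pos (by exact_mod_cast h0) hN
  apply Real.sin_pos_of_pos_of_lt_pi
  · have := Real.pi_pos
    positivity
  · nlinarith [Real.pi_pos]

/-- The bounds on `x` keep sin(πx/2N) nonzero, so the telescoped sum can be divided by it. -/
theorem two_mul_sum_cos {N x : ℕ} (h0 : 0 < x) (hx : x < 2 * N) :
    2 * ∑ j ∈ Finset.Icc 1 (N - 1), Real.cos (j * Real.pi * (x / N)) = -(-1) ^ x - 1 := by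
  have hN : (N : ℝ) ≠ 0 := by
    have : N ≠ 0 := by omega
    exact_mod_cast this
  have hs := sin_half_pos h0 hx
  have := two_mul_sin_mul_sum_cos (Real.pi * (x / N)) (N - 1)
  have e : ((N - 1 : ℕ) : ℝ) * (Real.pi * (x / N)) + Real.pi * (x / N) / 2 =
      x * Real.pi - Real.pi * (x / N) / 2 := by
    rw [Nat.cast_sub (by omega)]
    push_cast
    field_simp
    ring
  rw [e, Real.sin_sub, Real.sin_nat_mul_pi, Real.cos_nat_mul_pi] at this
  simp only [← mul_assoc] at this ⊢
  apply mul_left_cancel₀ hs.ne'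
  linarith

theorem one_sub_cos_pos {N j : ℕ} (hj : j ∈ Finset.Icc 1 (N - 1)) :
    0 < 1 - Real.cos (j * Real.pi * (1 / N)) := by
  rw [Finset.mem_Icc] at hj
  have hs := sin_half_pos (N := N) (x := j) (by omega) (by omega)
  have : Real.cos (j * Real.pi * (1 / N)) = 1 - 2 * Real.sin (Real.pi * (j / N) / 2) ^ 2 := by
    rw [show (j : ℝ) * Real.pi * (1 / N) = 2 * (Real.pi * (j / N) / 2) by ring, Real.cos_two_mul,
      Real.cos_sq']
    ring
  rw [this]
  have := pow_pos hs 2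
  linarith

/-- Raising `x` by 1 adds cos(jπ(x+1)/N) + cos(jπx/N) to the `j`-th term; summed over `j`, the
parity terms cancel and -1 remains. -/
theorem sum_g {N : ℕ} (x : ℕ) (hx0 : 0 < x) (hx : x < N) :
    ∑ j ∈ Finset.Icc 1 (N - 1), g j ((x : ℝ) / N) (1 / N) = N - x := by
  induction x, hx0 using Nat.le_induction with
  | base =>
    have h1 : ∀ j ∈ Finset.Icc 1 (N - 1), g j (((1 : ℕ) : ℝ) / N) (1 / N) =
        1 + Real.cos (j * Real.pi * ((1 : ℕ) / N)) := by
      intro j hj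
      have := one_sub_cos_pos hj
      unfold g
      rw [Nat.cast_one, div_eq_iff this.ne']
      have := Real.sin_sq_add_cos_sq (j * Real.pi * (1 / N))
      linear_combination this
    rw [Finset.sum_congr rfl h1, Finset.sum_add_distrib]
    have h2 := two_mul_sum_cos (N := N) (x := 1) (by omega) (by omega)
    simp only [Finset.sum_const, Nat.card_Icc, nsmul_eq_mul, mul_one, Nat.add_sub_cancel]
    rw [Nat.cast_sub (by omega)]
    linarith
  | succ x hx0 ih =>
    have h1 : ∀ j ∈ Finset.Icc 1 (N - 1), g j (((x + 1 : ℕ) : ℝ) / N) (1 / N) =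
        g j ((x : ℝ) / N) (1 / N) + (Real.cos (j * Real.pi * ((x + 1 : ℕ) / N)) +
          Real.cos (j * Real.pi * (x / N))) := by
      intro j hj
      have hp := one_sub_cos_pos hj
      unfold g
      rw [div_add' _ _ _ hp.ne', div_left_inj' hp.ne']
      rw [show (j : ℝ) * Real.pi * ((x + 1 : ℕ) / N) = j * Real.pi * (x / N) +
        j * Real.pi * (1 / N) by push_cast; ring, Real.sin_add, Real.cos_add]
      have := Real.sin_sq_add_cos_sq (j * Real.pi * (1 / N))
      linear_combination Real.cos (j * Real.pi * (x / N)) * this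
    have h2 := two_mul_sum_cos (N := N) (x := x) (by omega) (by omega)
    have h3 := two_mul_sum_cos (N := N) (x := x + 1) (by omega) (by omega)
    rw [pow_succ] at h3
    rw [Finset.sum_congr rfl h1, Finset.sum_add_distrib, Finset.sum_add_distrib, ih (by omega)]
    push_cast at h3 ⊢
    linarith

theorem hit_time_zero {N : ℕ} (r : ℝ) (x : ℕ) (hx0 : 0 < x) (hx : x < N) :
    hit N r 0 x = 0 := by
  have hN : (N : ℝ) ≠ 0 := by
    have : N ≠ 0 := by omega
    exact_mod_cast this
  simp only [hit, transient, pow_zero, mul_one]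
  rw [sum_g x hx0 hx]
  field_simp
  ring

/-- Since `r * (1 - r) ≤ 1 / 4`, the eigenvalue is at least (1 + cos)/2, which is positive. Together
with the upper bound, this makes the series over time converge. -/
theorem h_mem_Ioo {N j : ℕ} {r : ℝ} (hr₀ : 0 < r) (hr₁ : r < 1) (hj : j ∈ Finset.Icc 1 (N - 1)) :
    0 < h r j (1 / N) ∧ h r j (1 / N) < 1 := by
  have hp := one_sub_cos_pos hj
  have hq : 0 < r * (1 - r) := mul_pos hr₀ (by linarith)
  have hq' : r * (1 - r) ≤ 1 / 4 := by nlinarith [sq_nonneg (r - 1 / 2)]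
  have hc : -1 < Real.cos (j * Real.pi * (1 / N)) := by
    rw [Finset.mem_Icc] at hj
    have hN : (0 : ℝ) < N := by
      have : 0 < N := by omega
      exact_mod_cast this
    have h1 : (j : ℝ) * Real.pi * (1 / N) < Real.pi := by
      rw [mul_one_div, div_lt_iff₀ hN, mul_comm]
      have : (j : ℝ) < N := by exact_mod_cast (by omega : j < N)
      exact mul_lt_mul_of_pos_left this Real.pi_pos
    have h0 : 0 ≤ (j : ℝ) * Real.pi * (1 / N) := by
      have := Real.pi_pos
      positivity
    rw [← Real.cos_pi]
    exact Real.cos_lt_cos_of_nonneg_of_le_pi h0 le_rfl h1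
  unfold h
  constructor
  · nlinarith
  · nlinarith

/-! ### The stabilization probabilities -/

/-- The weight of a decision. -/
def wt (r : ℝ) (b : Bool) : ℝ := if b then r else 1 - r

theorem sum_wt (r : ℝ) : ∑ b, wt r b = 1 := by
  simp [wt]

/-- The probability that exactly one token is left after `t` steps, as a function of the
initial configuration. -/
def stab (N : ℕ) [NeZero N] (r : ℝ) : ℕ → Finset (ZMod N) → ℝ
  | 0, C => if C.card = 1 then 1 else 0
  | t + 1, C => ∑ pass : ZMod N → Bool, (∏ p, wt r (pass p)) * stab N r t (step C pass)

theorem IsStrictCyclic.exists_clockDist_eq {N : ℕ} {m : ℕ} {z : Fin (2 * m + 1) → ℤ}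
    (hz : IsStrictCyclic N z) {u v : Fin (2 * m + 1)} (huv : u ≠ v) :
    ∃ d : ℕ, 0 < d ∧ d < N ∧ clockDist N z u v = d := by
  have h0 := hz.last_lt
  have hb : ∀ w, z 0 ≤ z w ∧ z w ≤ z (Fin.last _) := fun w =>
    ⟨hz.isCyclic.mono (Fin.zero_le w), hz.isCyclic.mono (Fin.le_last w)⟩
  have h1 := hb u
  have h2 := hb v
  rcases lt_or_gt_of_ne huv with h | h
  · have := hz.strictMono h
    refine ⟨(z v - z u).toNat, by omega, by omega, ?_⟩
    rw [clockDist, if_pos h, ← Int.cast_natCast, Int.toNat_of_nonneg (by omega)]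
    push_cast
    ring
  · have := hz.strictMono h
    refine ⟨(z v - z u + N).toNat, by omega, by omega, ?_⟩
    have e : (((z v - z u + N).toNat : ℤ) : ℝ) = ((z v - z u + N : ℤ) : ℝ) := by
      rw [Int.toNat_of_nonneg (by omega)]
    rw [clockDist, if_neg h.not_gt]
    push_cast at e
    exact e.symm

theorem pfaff_zero (P : ℝ → ℝ) (N : ℕ) (z : Fin (2 * 0 + 1) → ℤ) : pfaff P N z = 1 := by
  simp [pfaff, pairSum_zero]

theorem IsStrictCyclic.pfaff_hit_zero {N : ℕ} (r : ℝ) {m : ℕ} {z : Fin (2 * (m + 1) + 1) → ℤ}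
    (hz : IsStrictCyclic N z) : pfaff (hit N r 0) N z = 0 := by
  rw [pfaff, pairSum, Finset.sum_eq_zero, zero_div]
  intro σ _
  rw [Finset.prod_eq_zero (Finset.mem_univ 0), mul_zero]
  obtain ⟨d, h0, h1, h2⟩ := hz.exists_clockDist_eq (u := σ (fstPos 0)) (v := σ (sndPos 0))
    (fun h => fstPos_ne_sndPos _ _ (σ.injective h))
  rw [h2, hit_time_zero r d h0 h1]

/-- Distinct processors use independent coins, so the average passes into each factor, where it is
the recursion of `hit` in time. -/
theorem IsStrictCyclic.sum_pfaff_hit {N : ℕ} [NeZero N] (r : ℝ) (t : ℕ) {m : ℕ}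
    {z : Fin (2 * m + 1) → ℤ} (hz : IsStrictCyclic N z) :
    ∑ pass : ZMod N → Bool, (∏ p, wt r (pass p)) *
      pfaff (hit N r t) N (fun u => z u + shift (pass (z u))) = pfaff (hit N r (t + 1)) N z := by
  have := sum_weight_mul_pairSum (fun _ : ZMod N => wt r) (fun _ => sum_wt r)
    (fun u => (z u : ZMod N)) hz.injective
    fun u v b c => hit N r t (clockDist N z u v + shift c - shift b)
  have e₁ : ∀ (pass : ZMod N → Bool) u v, clockDist N (fun u => z u + shift (pass (z u))) u v =
      clockDist N z u v + shift (pass (z v)) - shift (pass (z u)) := by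
    intro pass u v
    unfold clockDist
    push_cast
    ring
  have e₂ : ∀ u v, ∑ b, ∑ c, wt r b * wt r c *
      hit N r t (clockDist N z u v + shift c - shift b) = hit N r (t + 1) (clockDist N z u v) := by
    intro u v
    rw [← hit_add_one_add_hit_sub_one]
    simp only [Fintype.sum_bool, wt, shift]
    simp
    ring
  simp only [e₂] at this
  simp only [pfaff, ← mul_div_assoc, ← Finset.sum_div, e₁, this]

/-- Induction on time, and for each time on the number of pairs: a collision is removed without
changing either side, and a collision-free configuration either makes a step or, at time 0, is
evaluated directly. -/
theorem IsCyclic.pfaff_hit {N : ℕ} [NeZero N] (r : ℝ) (t : ℕ) : ∀ (m : ℕ)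
    (z : Fin (2 * m + 1) → ℤ), IsCyclic N z → pfaff (hit N r t) N z = stab N r t (oddSet N z) := by
  induction t with
  | zero =>
    intro m
    induction m using Nat.strong_induction_on with
    | _ m ih =>
      intro z hz
      by_cases h : ∃ k, Herman.rot N z k = z k
      · obtain ⟨k, hk⟩ := h
        obtain ⟨m', hm', z', h1, h2, h3⟩ := IsCyclic.exists_remove k hz k.isLt hk
        rw [← h2, ← h3 _ (by rw [hit_zero, hit_self, sub_zero]), ih m' hm' z' h1]
      · push Not at h
        have hs := hz.isStrictCyclic h
        rw [stab, hs.card_oddSet]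
        rcases m with _ | m
        · simp [pfaff_zero]
        · rw [hs.pfaff_hit_zero, if_neg (by omega)]
  | succ t iht =>
    intro m
    induction m using Nat.strong_induction_on with
    | _ m ih =>
      intro z hz
      by_cases h : ∃ k, Herman.rot N z k = z k
      · obtain ⟨k, hk⟩ := h
        obtain ⟨m', hm', z', h1, h2, h3⟩ := IsCyclic.exists_remove k hz k.isLt hk
        rw [← h2, ← h3 _ (by rw [hit_zero, hit_self, sub_zero]), ih m' hm' z' h1]
      · push Not at h
        have hs := hz.isStrictCyclic h
        rw [stab, ← hs.sum_pfaff_hit]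
        refine Finset.sum_congr rfl fun pass _ => ?_
        rw [hs.step_oddSet, iht _ _ (hs.isCyclic_add fun u => pass (z u))]

/-- The sum is affine in the position of each single token. Token 1 can therefore be replaced by a
random choice between the positions of tokens 0 and 2 with the same mean, and either choice creates
a collision that is removed by induction. -/
theorem IsCyclic.pfaff_limit {N : ℕ} [NeZero N] : ∀ (m : ℕ) (z : Fin (2 * m + 1) → ℤ),
    IsCyclic N z → pfaff (fun x => 1 - x / N) N z = 1 := by
  have hN : (N : ℝ) ≠ 0 := Nat.cast_ne_zero.2 (NeZero.ne N)
  intro m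
  induction m using Nat.strong_induction_on with
  | _ m ih =>
    have red : ∀ z : Fin (2 * m + 1) → ℤ, IsCyclic N z → (∃ k, Herman.rot N z k = z k) →
        pfaff (fun x => 1 - x / N) N z = 1 := by
      rintro z hz ⟨k, hk⟩
      obtain ⟨m', hm', z', h1, h2, h3⟩ := IsCyclic.exists_remove k hz k.isLt hk
      rw [← h3 _ (by rw [div_self hN]; simp), ih m' hm' z' h1]
    intro z hz
    by_cases h : ∃ k, Herman.rot N z k = z k
    · exact red z hz h
    push Not at h
    have hs := hz.isStrictCyclic h
    rcases m with _ | m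
    · exact pfaff_zero _ _ _
    set i₀ : Fin (2 * (m + 1) + 1) := ⟨0, by omega⟩
    set i₁ : Fin (2 * (m + 1) + 1) := ⟨1, by omega⟩ with hi₁
    set i₂ : Fin (2 * (m + 1) + 1) := ⟨2, by omega⟩
    have h01 : z i₀ < z i₁ := hs.strictMono (by simp [i₀, i₁])
    have h12 : z i₁ < z i₂ := hs.strictMono (Nat.lt_succ_self 1)
    have hR01 : (z i₀ : ℝ) < z i₁ := by exact_mod_cast h01
    have hR12 : (z i₁ : ℝ) < z i₂ := by exact_mod_cast h12
    set pos : Fin (2 * (m + 1) + 1) → Bool → ℤ := fun u b =>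
      if u = i₁ then (if b then z i₂ else z i₀) else z u with hpos
    -- The weights at `i₁` give the mean `z i₁`; the other tokens ignore their bit, and their
    -- weights 1/2 are only fillers.
    set w : Fin (2 * (m + 1) + 1) → Bool → ℝ := fun u b =>
      if u = i₁ then (if b then (z i₁ - z i₀) / (z i₂ - z i₀) else (z i₂ - z i₁) / (z i₂ - z i₀))
        else 1 / 2 with hw
    have hd : (z i₂ : ℝ) - z i₀ ≠ 0 := by linarith
    have hw1 : ∀ u, ∑ b, w u b = 1 := by
      intro u
      simp only [hw, Fintype.sum_bool]
      by_cases hu : u = i₁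
      · simp only [hu, if_true, Bool.false_eq_true, if_false]
        field_simp
        ring
      · simp only [hu, if_false]
        norm_num
    have hmean : ∀ u, ∑ b, w u b * pos u b = z u := by
      intro u
      simp only [hw, hpos, Fintype.sum_bool]
      by_cases hu : u = i₁
      · simp only [hu, if_true, Bool.false_eq_true, if_false]
        field_simp
        ring
      · simp only [hu, if_false]
        ring
    have hcyc : ∀ f : Fin (2 * (m + 1) + 1) → Bool,
        pfaff (fun x => 1 - x / N) N (fun u => pos u (f u)) = 1 := by
      intro f
      have hv : ∀ u : Fin (2 * (m + 1) + 1), u ≠ i₁ → pos u (f u) = z u := fun u hu => by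
        simp [hpos, hu]
      have hv1 : z i₀ ≤ pos i₁ (f i₁) ∧ pos i₁ (f i₁) ≤ z i₂ := by
        simp only [hpos, if_true]
        split_ifs <;> omega
      apply red
      · constructor
        · intro u v huv
          show pos u (f u) ≤ pos v (f v)
          by_cases hu : u = i₁
          · by_cases hv' : v = i₁
            · rw [hu, hv']
            · rw [hv v hv', hu]
              refine hv1.2.trans (hz.mono ?_)
              rw [hu] at huv
              have : (v : ℕ) ≠ 1 := fun e => hv' (Fin.ext e)
              have h1 : 1 ≤ (v : ℕ) := huv
              show 2 ≤ (v : ℕ)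
              omega
          · rw [hv u hu]
            by_cases hv' : v = i₁
            · rw [hv']
              refine le_trans (hz.mono ?_) hv1.1
              rw [hv'] at huv
              have : (u : ℕ) ≠ 1 := fun e => hu (Fin.ext e)
              have h1 : (u : ℕ) ≤ 1 := huv
              show (u : ℕ) ≤ 0
              omega
            · rw [hv v hv']
              exact hz.mono huv
        · have e0 := hv 0 (fun e => by have := congrArg Fin.val e; simp [i₁] at this)
          have e1 := hv (Fin.last _) (fun e => by have := congrArg Fin.val e; simp [i₁] at this)
          rw [e0, e1]
          exact hz.last_le
      · cases hf : f i₁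
        · refine ⟨i₀, ?_⟩
          rw [rot_of_lt N _ (by omega)]
          show pos i₁ (f i₁) = pos i₀ (f i₀)
          rw [hv i₀ (by simp [i₀, i₁]), hf]
          simp [hpos]
        · refine ⟨i₁, ?_⟩
          rw [hi₁, rot_of_lt N _ (by omega)]
          show pos i₂ (f i₂) = pos i₁ (f i₁)
          rw [hv i₂ (by simp [i₂, i₁]), hf]
          simp [hpos]
    have avg := sum_weight_mul_pairSum w hw1 id Function.injective_id
      fun u v b c => 1 - ((pos v c : ℝ) - pos u b + if u < v then 0 else (N : ℝ)) / N
    have hlin : ∀ u v, ∑ b, ∑ c, w (id u) b * w (id v) c *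
        (1 - ((pos v c : ℝ) - pos u b + if u < v then 0 else (N : ℝ)) / N) =
        1 - clockDist N z u v / N := by
      intro u v
      have a1 := hw1 u
      have a2 := hw1 v
      have a3 := hmean u
      have a4 := hmean v
      unfold clockDist
      rw [← a3, ← a4]
      simp only [Fintype.sum_bool, id] at a1 a2 ⊢
      have b1 : w u false = 1 - w u true := by linarith
      have b2 : w v false = 1 - w v true := by linarith
      rw [b1, b2]
      ring
    simp only [hlin] at avg
    have hcyc' : ∀ f : Fin (2 * (m + 1) + 1) → Bool, pairSum (fun u v =>
        1 - ((pos v (f (id v)) : ℝ) - pos u (f (id u)) + if u < v then 0 else (N : ℝ)) / N) =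
        ((m + 1).factorial : ℝ) := by
      intro f
      have := hcyc f
      rw [pfaff, div_eq_one_iff_eq (Nat.cast_ne_zero.2 (Nat.factorial_ne_zero _))] at this
      exact this
    simp only [hcyc', ← Finset.sum_mul, ← Fintype.prod_sum, hw1] at avg
    rw [pfaff, ← avg]
    have := Nat.factorial_ne_zero (m + 1)
    simp [this]

/-! ### The law of the configurations -/

theorem config_congr {N : ℕ} (C₀ : Finset (ZMod N)) {c c' : ℕ → ZMod N → Bool} {t : ℕ}
    (hc : ∀ s < t, c s = c' s) : config C₀ c t = config C₀ c' t := by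
  induction t with
  | zero => rfl
  | succ t ih =>
    rw [config, config, ih fun s hs => hc s (by omega), hc t (by omega)]

theorem card_step_of_card_eq_one {N : ℕ} {C : Finset (ZMod N)} (hC : C.card = 1)
    (pass : ZMod N → Bool) : (step C pass).card = 1 := by
  obtain ⟨p, rfl⟩ := Finset.card_eq_one.1 hC
  cases hp : pass p <;> simp [step, Finset.filter_singleton, hp, symmDiff]

/-- A single token stays single, so the configuration at time `t` alone decides whether the process
has finished by then. -/
theorem lt_stabTime_iff {N : ℕ} (C₀ : Finset (ZMod N)) (c : ℕ → ZMod N → Bool) (t : ℕ) :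
    (t : ℕ∞) < stabTime C₀ c ↔ (config C₀ c t).card ≠ 1 := by
  have hmono : ∀ s d, (config C₀ c s).card = 1 → (config C₀ c (s + d)).card = 1 := by
    intro s d hs
    induction d with
    | zero => exact hs
    | succ d ih => exact card_step_of_card_eq_one ih _
  constructor
  · intro h hc
    exact absurd (iInf₂_le (f := fun (t : ℕ) (_ : (config C₀ c t).card = 1) => (t : ℕ∞)) t hc)
      (not_le.2 h)
  · intro h
    have : ((t + 1 : ℕ) : ℕ∞) ≤ stabTime C₀ c := by
      refine le_iInf₂ fun s hs => ?_
      have : t < s := by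
        by_contra! hst
        obtain ⟨d, rfl⟩ := Nat.exists_eq_add_of_le hst
        exact h (hmono s d hs)
      exact_mod_cast this
    refine lt_of_lt_of_le ?_ this
    exact_mod_cast Nat.lt_succ_self t

theorem toENNReal_eq_tsum (T : ℕ∞) :
    (T : ℝ≥0∞) = ∑' t : ℕ, if (t : ℕ∞) < T then 1 else 0 := by
  induction T using ENat.recTopCoe with
  | top => simp
  | coe n =>
    rw [tsum_eq_sum (s := Finset.range n)]
    · simp only [Nat.cast_lt]
      rw [Finset.sum_congr rfl fun i hi => if_pos (Finset.mem_range.1 hi)]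
      simp
    · intro i hi
      simpa using hi

theorem integral_comp_eq_sum {Ω α : Type*} [MeasurableSpace Ω] (μ : Measure Ω)
    [IsProbabilityMeasure μ] [Fintype α] (X : Ω → α)
    (hX : ∀ a, MeasurableSet {ω | X ω = a}) (φ : α → ℝ) :
    ∫ ω, φ (X ω) ∂μ = ∑ a, μ.real {ω | X ω = a} * φ a := by
  classical
  have : ∀ ω, φ (X ω) = ∑ a, Set.indicator {ω | X ω = a} (fun _ => φ a) ω := by
    intro ω
    rw [Finset.sum_eq_single (X ω)]
    · simp
    · intro b _ hb
      exact Set.indicator_of_notMem (fun h => hb (Eq.symm h)) _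
    · simp
  simp only [this]
  rw [integral_finsetSum]
  · refine Finset.sum_congr rfl fun a _ => ?_
    rw [integral_indicator_const _ (hX a), smul_eq_mul]
  · intro a _
    exact (integrable_const _).indicator (hX a)

section Coins

variable {Ω : Type*} [MeasurableSpace Ω] {μ : Measure Ω} [IsProbabilityMeasure μ] {N : ℕ}
  [NeZero N] {r : ℝ} {coin : ℕ → ZMod N → Ω → Bool}

omit [NeZero N] in
theorem IsCoinFamily.measureReal_coin (hcoin : IsCoinFamily μ N r coin) (hr₀ : 0 ≤ r)
    (t : ℕ) (p : ZMod N) (b : Bool) : μ.real {ω | coin t p ω = b} = wt r b := by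
  have htrue : μ.real {ω | coin t p ω = true} = r := by
    rw [measureReal_def, hcoin.prob, ENNReal.toReal_ofReal hr₀]
  have hm : MeasurableSet {ω | coin t p ω = true} :=
    hcoin.measurable t p (measurableSet_singleton true)
  cases b
  · have : {ω | coin t p ω = false} = {ω | coin t p ω = true}ᶜ := by ext; simp
    rw [this, probReal_compl_eq_one_sub hm, htrue]
    rfl
  · exact htrue

theorem IsCoinFamily.measureReal_row (hcoin : IsCoinFamily μ N r coin) (hr₀ : 0 ≤ r)
    (t : ℕ) (b : ZMod N → Bool) :
    μ.real {ω | (fun p => coin t p ω) = b} = ∏ p, wt r (b p) := by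
  have hi : iIndepFun (fun p : ZMod N => coin t p) μ :=
    hcoin.indep.precomp (g := fun p : ZMod N => (t, p)) fun p q h => by simpa using h
  have := hi.measure_inter_preimage_eq_mul Finset.univ (sets := fun p => {b p})
    fun _ _ => measurableSet_singleton _
  have hs : {ω | (fun p => coin t p ω) = b} = ⋂ p ∈ Finset.univ, coin t p ⁻¹' {b p} := by
    ext ω
    simp [funext_iff]
  rw [hs, measureReal_def, this, ENNReal.toReal_prod]
  exact Finset.prod_congr rfl fun p _ => hcoin.measureReal_coin hr₀ t p (b p)

omit [IsProbabilityMeasure μ] in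
theorem IsCoinFamily.measurableSet_config (hcoin : IsCoinFamily μ N r coin)
    (C₀ D : Finset (ZMod N)) (t : ℕ) :
    MeasurableSet {ω | config C₀ (fun t p => coin t p ω) t = D} := by
  induction t generalizing D with
  | zero => simp [config]
  | succ t ih =>
    have : {ω | config C₀ (fun t p => coin t p ω) (t + 1) = D} =
        ⋃ E : Finset (ZMod N), ⋃ b : ZMod N → Bool, ⋃ _ : step E b = D,
          ({ω | config C₀ (fun t p => coin t p ω) t = E} ∩ ⋂ p, coin t p ⁻¹' {b p}) := by
      ext ω
      simp only [config, Set.mem_ofPred_eq, Set.mem_iUnion, Set.mem_inter_iff, Set.mem_iInter,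
        Set.mem_preimage, Set.mem_singleton_iff]
      constructor
      · intro h
        exact ⟨_, _, h, rfl, fun p => rfl⟩
      · rintro ⟨E, b, h, rfl, hb⟩
        rw [← h]
        congr 1
        exact funext hb
    rw [this]
    refine MeasurableSet.iUnion fun E => MeasurableSet.iUnion fun b => MeasurableSet.iUnion fun _ =>
      (ih E).inter (MeasurableSet.iInter fun p => ?_)
    exact hcoin.measurable t p (measurableSet_singleton _)

omit [IsProbabilityMeasure μ] in
theorem IsCoinFamily.measurableSet_card_config (hcoin : IsCoinFamily μ N r coin)
    (C₀ : Finset (ZMod N)) (t : ℕ) :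
    MeasurableSet {ω | (config C₀ (fun t p => coin t p ω) t).card = 1} := by
  have : {ω | (config C₀ (fun t p => coin t p ω) t).card = 1} =
      ⋃ D : Finset (ZMod N), ⋃ _ : D.card = 1, {ω | config C₀ (fun t p => coin t p ω) t = D} := by
    ext ω
    simp
  rw [this]
  exact MeasurableSet.iUnion fun D => MeasurableSet.iUnion fun _ =>
    hcoin.measurableSet_config C₀ D t

/-- The configuration at time `t` is a function of the earlier coins only, hence independent of the
coins tossed at time `t`. -/
theorem IsCoinFamily.measureReal_inter (hcoin : IsCoinFamily μ N r coin) (hr₀ : 0 ≤ r)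
    (C₀ D : Finset (ZMod N)) (t : ℕ) (b : ZMod N → Bool) :
    μ.real {ω | (config C₀ (fun t p => coin t p ω) t, fun p => coin t p ω) = (D, b)} =
      μ.real {ω | config C₀ (fun t p => coin t p ω) t = D} * ∏ p, wt r (b p) := by
  classical
  set S : Finset (ℕ × ZMod N) := Finset.range t ×ˢ Finset.univ
  set T : Finset (ℕ × ZMod N) := {t} ×ˢ Finset.univ
  have hST : Disjoint S T := by
    rw [Finset.disjoint_left]
    rintro ⟨s, p⟩ h1 h2
    simp only [S, T, Finset.mem_product, Finset.mem_range, Finset.mem_singleton] at h1 h2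
    omega
  have hind := hcoin.indep.indepFun_finset S T hST fun i => hcoin.measurable i.1 i.2
  -- The filler `false` is harmless, since coins from time `t` on do not influence the configuration
  -- at time `t`.
  set A : Set (S → Bool) := {y | config C₀
    (fun s p => if h : (s, p) ∈ S then y ⟨(s, p), h⟩ else false) t = D}
  set B : Set (T → Bool) := {y | ∀ p (h : (t, p) ∈ T), y ⟨(t, p), h⟩ = b p}
  have := hind.measure_inter_preimage_eq_mul A B (Set.toFinite A).measurableSet
    (Set.toFinite B).measurableSet
  have hA : (fun ω (i : S) => coin i.1.1 i.1.2 ω) ⁻¹' A =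
      {ω | config C₀ (fun t p => coin t p ω) t = D} := by
    ext ω
    simp only [A, Set.mem_preimage, Set.mem_ofPred_eq]
    rw [config_congr (c' := fun t p => coin t p ω)]
    intro s hs
    funext p
    rw [dif_pos (by simpa [S] using hs)]
  have hB : (fun ω (i : T) => coin i.1.1 i.1.2 ω) ⁻¹' B = {ω | (fun p => coin t p ω) = b} := by
    ext ω
    simp [B, T, funext_iff]
  have hAB : {ω | (config C₀ (fun t p => coin t p ω) t, fun p => coin t p ω) = (D, b)} =
      {ω | config C₀ (fun t p => coin t p ω) t = D} ∩ {ω | (fun p => coin t p ω) = b} := by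
    ext ω
    simp
  rw [hAB, ← hcoin.measureReal_row hr₀ t b, measureReal_def, measureReal_def, measureReal_def,
    ← ENNReal.toReal_mul, ← hA, ← hB]
  exact congrArg ENNReal.toReal this

/-- `stab` recurses on the first step and `config` on the last one. Keeping `s` general lets a step
pass from one to the other; the case `s = 0` identifies `stab` as a probability. -/
theorem IsCoinFamily.integral_stab (hcoin : IsCoinFamily μ N r coin) (hr₀ : 0 ≤ r)
    (C₀ : Finset (ZMod N)) (s t : ℕ) :
    ∫ ω, stab N r s (config C₀ (fun t p => coin t p ω) t) ∂μ = stab N r (s + t) C₀ := by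
  induction t generalizing s with
  | zero => simp [config]
  | succ t ih =>
    rw [show s + (t + 1) = s + 1 + t by ring, ← ih (s + 1),
      integral_comp_eq_sum μ _ (fun D => hcoin.measurableSet_config C₀ D t)]
    have hpair : ∀ x : Finset (ZMod N) × (ZMod N → Bool), MeasurableSet
        {ω | (config C₀ (fun t p => coin t p ω) t, fun p => coin t p ω) = x} := by
      rintro ⟨D, b⟩
      have : {ω | (config C₀ (fun t p => coin t p ω) t, fun p => coin t p ω) = (D, b)} =
          {ω | config C₀ (fun t p => coin t p ω) t = D} ∩ ⋂ p, coin t p ⁻¹' {b p} := by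
        ext ω
        simp [funext_iff]
      rw [this]
      exact (hcoin.measurableSet_config C₀ D t).inter
        (MeasurableSet.iInter fun p => hcoin.measurable t p (measurableSet_singleton _))
    have := integral_comp_eq_sum μ _ hpair fun x => stab N r s (step x.1 x.2)
    refine Eq.trans this ?_
    rw [Fintype.sum_prod_type]
    refine Finset.sum_congr rfl fun D _ => ?_
    simp only [stab, Finset.mul_sum, hcoin.measureReal_inter hr₀, mul_assoc]

theorem IsCoinFamily.measureReal_card_config (hcoin : IsCoinFamily μ N r coin) (hr₀ : 0 ≤ r)
    (C₀ : Finset (ZMod N)) (t : ℕ) :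
    μ.real {ω | (config C₀ (fun t p => coin t p ω) t).card = 1} = stab N r t C₀ := by
  have h := hcoin.integral_stab hr₀ C₀ 0 t
  rw [zero_add] at h
  rw [← h]
  have hm := hcoin.measurableSet_card_config C₀ t
  have h1 : ∀ ω, stab N r 0 (config C₀ (fun t p => coin t p ω) t) =
      Set.indicator {ω | (config C₀ (fun t p => coin t p ω) t).card = 1} (fun _ => (1 : ℝ)) ω := by
    intro ω
    simp only [stab, Set.indicator_apply, Set.mem_ofPred_eq]
  simp only [h1]
  rw [integral_indicator_const _ hm]
  simp

/-- The expected time is the sum of the probabilities that it has not been reached. -/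
theorem IsCoinFamily.expectedTime_of_hasSum (hcoin : IsCoinFamily μ N r coin) (hr₀ : 0 ≤ r)
    (C₀ : Finset (ZMod N)) {s : ℝ} (hs : HasSum (fun t => 1 - stab N r t C₀) s) :
    expectedTime μ C₀ coin ≠ ⊤ ∧ (expectedTime μ C₀ coin).toReal = s := by
  have hm := hcoin.measurableSet_card_config C₀
  have hprob : ∀ t, μ.real {ω | (config C₀ (fun t p => coin t p ω) t).card = 1}ᶜ =
      1 - stab N r t C₀ := fun t => by
    rw [probReal_compl_eq_one_sub (hm t), hcoin.measureReal_card_config hr₀]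
  have hnonneg : ∀ t, 0 ≤ 1 - stab N r t C₀ := fun t => by
    rw [← hprob]; exact measureReal_nonneg
  have key : expectedTime μ C₀ coin = ENNReal.ofReal s := by
    have hind : ∀ ω, (stabTime C₀ (fun t p => coin t p ω) : ℝ≥0∞) = ∑' t : ℕ,
        Set.indicator {ω | (config C₀ (fun t p => coin t p ω) t).card = 1}ᶜ
          (fun _ => (1 : ℝ≥0∞)) ω := by
      intro ω
      rw [toENNReal_eq_tsum]
      refine tsum_congr fun t => ?_
      simp only [lt_stabTime_iff, Set.indicator_apply, Set.mem_compl_iff, Set.mem_ofPred_eq]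
    unfold expectedTime
    simp only [hind]
    rw [lintegral_tsum fun t => (measurable_const.indicator (hm t).compl).aemeasurable,
      ← hs.tsum_eq, ENNReal.ofReal_tsum_of_nonneg hnonneg hs.summable]
    refine tsum_congr fun t => ?_
    rw [lintegral_indicator_const (hm t).compl, one_mul, ← hprob, ofReal_measureReal]
  rw [key]
  refine ⟨ENNReal.ofReal_ne_top, ENNReal.toReal_ofReal ?_⟩
  exact hs.nonneg hnonneg

end Coins

/-! ### Pairings and permutations -/

/-- The pairs of the word `σ`. -/
def pairSet {m : ℕ} (σ : Perm (Fin (2 * m + 1))) : Finset (Fin (2 * m + 1) × Fin (2 * m + 1)) :=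
  Finset.univ.image fun i : Fin m => (σ (fstPos i), σ (sndPos i))

/-- The directed pair that encodes the collision in which `u` catches up with `v`. -/
def dirOf {M : ℕ} (p : Fin M × Fin M) : DPair M :=
  if p.1 < p.2 then (p.1, p.2, Direction.down) else (p.2, p.1, Direction.up)

theorem dirOf_injective {M : ℕ} : Function.Injective (dirOf (M := M)) := by
  rintro ⟨u, v⟩ ⟨u', v'⟩ h
  unfold dirOf at h
  split_ifs at h <;> simp_all

theorem pair_injective {m : ℕ} (σ : Perm (Fin (2 * m + 1))) :
    Function.Injective fun i : Fin m => (σ (fstPos i), σ (sndPos i)) := by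
  intro i j h
  exact fstPos_injective (σ.injective (Prod.ext_iff.1 h).1)

theorem card_pairSet {m : ℕ} (σ : Perm (Fin (2 * m + 1))) : (pairSet σ).card = m := by
  rw [pairSet, Finset.card_image_of_injective _ (pair_injective σ)]
  simp

theorem arranges_iff {m : ℕ} (σ : Perm (Fin (2 * m + 1)))
    (w : Finset (Fin (2 * m + 1) × Fin (2 * m + 1))) : Arranges σ w ↔ w = pairSet σ := by
  have : (Finset.univ.image fun i : Fin ((2 * m + 1 - 1) / 2) =>
      (σ ⟨2 * i, by omega⟩, σ ⟨2 * i + 1, by omega⟩)) = pairSet σ := by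
    ext p
    simp only [pairSet, Finset.mem_image, Finset.mem_univ, true_and]
    constructor
    · rintro ⟨i, rfl⟩
      exact ⟨⟨i, by omega⟩, rfl⟩
    · rintro ⟨i, rfl⟩
      exact ⟨⟨i, by omega⟩, rfl⟩
  rw [Arranges, this]

theorem pairSet_mul_pairPerm {m : ℕ} (σ : Perm (Fin (2 * m + 1))) (π : Perm (Fin m)) :
    pairSet (σ * pairPerm π) = pairSet σ := by
  ext p
  simp only [pairSet, Finset.mem_image, Finset.mem_univ, true_and, Perm.mul_apply, pairPerm_fst,
    pairPerm_snd]
  exact π.surjective.exists (p := fun i => (σ (fstPos i), σ (sndPos i)) = p).symm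

theorem fstPos_ne_last {m : ℕ} (i : Fin m) : fstPos i ≠ Fin.last (2 * m) := by
  intro h
  have := congrArg Fin.val h
  simp [fstPos] at this
  omega

theorem sndPos_ne_last {m : ℕ} (i : Fin m) : sndPos i ≠ Fin.last (2 * m) := by
  intro h
  have := congrArg Fin.val h
  simp [sndPos] at this
  omega

/-- Words with the same ordered pairs list them in different orders, and the unpaired letter is then
forced. -/
theorem exists_eq_mul_pairPerm {m : ℕ} {σ τ : Perm (Fin (2 * m + 1))}
    (h : pairSet σ = pairSet τ) : ∃ π : Perm (Fin m), τ * pairPerm π = σ := by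
  have hex : ∀ i : Fin m, ∃ j : Fin m, (τ (fstPos j), τ (sndPos j)) =
      (σ (fstPos i), σ (sndPos i)) := by
    intro i
    have hi : (σ (fstPos i), σ (sndPos i)) ∈ pairSet τ := by
      rw [← h]
      exact Finset.mem_image_of_mem _ (Finset.mem_univ i)
    simpa only [pairSet, Finset.mem_image, Finset.mem_univ, true_and] using hi
  choose f hf using hex
  have hinj : Function.Injective f := by
    intro i j hij
    apply pair_injective σ
    show (σ (fstPos i), σ (sndPos i)) = (σ (fstPos j), σ (sndPos j))
    rw [← hf i, ← hf j, hij]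
  set π : Perm (Fin m) := Equiv.ofBijective f (Finite.injective_iff_bijective.1 hinj) with hπ
  have h₁ : ∀ i, (τ * pairPerm π) (fstPos i) = σ (fstPos i) := fun i => by
    rw [Perm.mul_apply, pairPerm_fst]
    exact (Prod.ext_iff.1 (hf i)).1
  have h₂ : ∀ i, (τ * pairPerm π) (sndPos i) = σ (sndPos i) := fun i => by
    rw [Perm.mul_apply, pairPerm_snd]
    exact (Prod.ext_iff.1 (hf i)).2
  refine ⟨π, Equiv.ext fun k => ?_⟩
  refine forall_pos (p := fun k => (τ * pairPerm π) k = σ k) h₁ h₂ ?_ k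
  obtain ⟨k, hk⟩ := (τ * pairPerm π).surjective (σ (Fin.last (2 * m)))
  have : k = Fin.last (2 * m) := by
    revert hk
    refine forall_pos (p := fun k => (τ * pairPerm π) k = σ (Fin.last (2 * m)) →
      k = Fin.last (2 * m)) ?_ ?_ (fun _ => rfl) k
    · intro i hi
      rw [h₁] at hi
      exact absurd (σ.injective hi) (fstPos_ne_last i)
    · intro i hi
      rw [h₂] at hi
      exact absurd (σ.injective hi) (sndPos_ne_last i)
  rw [← this, hk, this]

theorem sign_eq_of_pairSet_eq {m : ℕ} {σ τ : Perm (Fin (2 * m + 1))}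
    (h : pairSet σ = pairSet τ) : sign σ = sign τ := by
  obtain ⟨π, rfl⟩ := exists_eq_mul_pairPerm h
  rw [Perm.sign_mul, sign_pairPerm, mul_one]

/-- All words that arrange the same pairs have the same sign, so the existential in the definition
can be tested on `σ`. -/
theorem pairingSign_pairSet {m : ℕ} (σ : Perm (Fin (2 * m + 1))) :
    pairingSign (pairSet σ) = ((sign σ : ℤ) : ℝ) := by
  have : (∃ τ : Perm (Fin (2 * m + 1)), Arranges τ (pairSet σ) ∧ sign τ = 1) ↔ sign σ = 1 := by
    constructor
    · rintro ⟨τ, h, hτ⟩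
      rw [sign_eq_of_pairSet_eq ((arranges_iff _ _).1 h), hτ]
    · intro h
      exact ⟨σ, (arranges_iff _ _).2 rfl, h⟩
  unfold pairingSign
  simp only [this]
  rcases Int.units_eq_one_or (sign σ) with h | h <;> simp [h]

/-- The directed pairs of the word `σ`. -/
def dirSet {m : ℕ} (σ : Perm (Fin (2 * m + 1))) : Finset (DPair (2 * m + 1)) :=
  (pairSet σ).image dirOf

theorem dirSet_eq_iff {m : ℕ} {σ τ : Perm (Fin (2 * m + 1))} :
    dirSet σ = dirSet τ ↔ pairSet σ = pairSet τ :=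
  (Finset.image_injective dirOf_injective).eq_iff

/-- The word `σ`, with every pair put into increasing order. -/
def increasing {m : ℕ} (σ : Perm (Fin (2 * m + 1))) : Perm (Fin (2 * m + 1)) :=
  σ * flipPerm (Finset.univ.filter fun i => ¬ σ (fstPos i) < σ (sndPos i))

theorem increasing_lt {m : ℕ} (σ : Perm (Fin (2 * m + 1))) (i : Fin m) :
    increasing σ (fstPos i) < increasing σ (sndPos i) := by
  simp only [increasing, Perm.mul_apply, flipPerm_fst, flipPerm_snd, Finset.mem_filter,
    Finset.mem_univ, true_and]
  by_cases h : σ (fstPos i) < σ (sndPos i)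
  · simp [h]
  · simp only [h, not_false_eq_true, if_true]
    exact lt_of_le_of_ne (not_lt.1 h) fun e => fstPos_ne_sndPos i i (σ.injective e).symm

theorem undirected_dirSet {m : ℕ} (σ : Perm (Fin (2 * m + 1))) :
    undirected (dirSet σ) = pairSet (increasing σ) := by
  unfold undirected dirSet pairSet
  rw [Finset.image_image, Finset.image_image]
  refine Finset.image_congr fun i _ => ?_
  simp only [increasing, Function.comp_apply, Perm.mul_apply, flipPerm_fst, flipPerm_snd,
    Finset.mem_filter, Finset.mem_univ, true_and, dirOf]
  by_cases h : σ (fstPos i) < σ (sndPos i) <;> simp [h]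

theorem card_dirSet {m : ℕ} (σ : Perm (Fin (2 * m + 1))) : (dirSet σ).card = m := by
  rw [dirSet, Finset.card_image_of_injective _ dirOf_injective, card_pairSet]

/-- Each `up` pair is a pair that `increasing σ` transposes, so the power of -1 undoes the change of
sign from `σ` to `increasing σ`. -/
theorem dirSign_dirSet {m : ℕ} (σ : Perm (Fin (2 * m + 1))) :
    dirSign (dirSet σ) = ((sign σ : ℤ) : ℝ) := by
  set B := Finset.univ.filter fun i : Fin m => ¬ σ (fstPos i) < σ (sndPos i) with hB
  have hcard : ((dirSet σ).filter fun p => p.2.2 = Direction.up).card = B.card := by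
    have : ((dirSet σ).filter fun p => p.2.2 = Direction.up) =
        B.image fun i => dirOf (σ (fstPos i), σ (sndPos i)) := by
      rw [dirSet, pairSet, Finset.image_image, Finset.filter_image]
      congr 1
      ext i
      simp only [hB, Finset.mem_filter, Finset.mem_univ, true_and, Function.comp_apply, dirOf]
      by_cases h : σ (fstPos i) < σ (sndPos i) <;> simp [h]
    rw [this]
    exact Finset.card_image_of_injective _ (dirOf_injective.comp (pair_injective σ))
  rw [dirSign, undirected_dirSet, pairingSign_pairSet, hcard, increasing, Perm.sign_mul,
    sign_flipPerm]
  push_cast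
  rw [mul_assoc, ← mul_pow]
  simp

theorem dirSet_mem_directedPairings {m : ℕ} (σ : Perm (Fin (2 * m + 1))) :
    dirSet σ ∈ directedPairings (2 * m + 1) := by
  unfold directedPairings
  simp only [Finset.mem_filter, Finset.mem_univ, true_and]
  refine ⟨by rw [card_dirSet]; omega, ?_⟩
  rw [undirected_dirSet]
  refine ⟨by rw [card_pairSet]; omega, ?_, increasing σ (Fin.last _), ?_⟩
  · intro p hp
    obtain ⟨i, _, rfl⟩ := Finset.mem_image.1 hp
    exact increasing_lt σ i
  · rw [Finset.eq_univ_iff_forall]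
    intro x
    obtain ⟨k, rfl⟩ := (increasing σ).surjective x
    refine forall_pos (p := fun k => increasing σ k ∈ insert (increasing σ (Fin.last (2 * m)))
      ((pairSet (increasing σ)).image Prod.fst ∪ (pairSet (increasing σ)).image Prod.snd))
      ?_ ?_ (Finset.mem_insert_self _ _) k
    · intro i
      refine Finset.mem_insert_of_mem (Finset.mem_union_left _ ?_)
      exact Finset.mem_image_of_mem Prod.fst (Finset.mem_image_of_mem
        (fun i : Fin m => (increasing σ (fstPos i), increasing σ (sndPos i))) (Finset.mem_univ i))
    · intro i
      refine Finset.mem_insert_of_mem (Finset.mem_union_right _ ?_)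
      exact Finset.mem_image_of_mem Prod.snd (Finset.mem_image_of_mem
        (fun i : Fin m => (increasing σ (fstPos i), increasing σ (sndPos i))) (Finset.mem_univ i))

/-- The ordered pair that belongs to a directed pair. -/
def pairOf {M : ℕ} (p : DPair M) : Fin M × Fin M :=
  if p.2.2 = Direction.down then (p.1, p.2.1) else (p.2.1, p.1)

theorem dirOf_pairOf {M : ℕ} {p : DPair M} (hp : p.1 < p.2.1) : dirOf (pairOf p) = p := by
  obtain ⟨u, v, d⟩ := p
  have h : u < v := hp
  cases d <;> simp [pairOf, dirOf, h, h.not_gt]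

theorem exists_dirSet_eq {m : ℕ} {w : Finset (DPair (2 * m + 1))}
    (hw : w ∈ directedPairings (2 * m + 1)) : ∃ σ, dirSet σ = w := by
  unfold directedPairings at hw
  simp only [Finset.mem_filter, Finset.mem_univ, true_and] at hw
  obtain ⟨hcard, -, hlt, w₀, hw₀⟩ := hw
  have hcard' : w.card = m := by omega
  let e : w ≃ Fin m := Finset.equivFinOfCardEq hcard'
  let f : (Fin m × Fin 2) ⊕ Fin 1 → Fin (2 * m + 1) := Sum.elim
    (fun x => if x.2 = 0 then (pairOf (e.symm x.1 : DPair (2 * m + 1))).1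
      else (pairOf (e.symm x.1 : DPair (2 * m + 1))).2) fun _ => w₀
  have hmem : ∀ p ∈ w, (∃ a, f a = p.1) ∧ ∃ a, f a = p.2.1 := by
    rintro p hp
    obtain ⟨i, hi⟩ := e.symm.surjective ⟨p, hp⟩
    obtain ⟨u, v, d⟩ := p
    cases d
    · exact ⟨⟨Sum.inl (i, 0), by simp [f, hi, pairOf]⟩, Sum.inl (i, 1), by simp [f, hi, pairOf]⟩
    · exact ⟨⟨Sum.inl (i, 1), by simp [f, hi, pairOf]⟩, Sum.inl (i, 0), by simp [f, hi, pairOf]⟩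
  have hsurj : Function.Surjective f := by
    intro x
    have hx : x ∈ insert w₀ ((undirected w).image Prod.fst ∪ (undirected w).image Prod.snd) := by
      rw [hw₀]
      exact Finset.mem_univ x
    rcases Finset.mem_insert.1 hx with rfl | hx
    · exact ⟨Sum.inr 0, rfl⟩
    · rcases Finset.mem_union.1 hx with hx | hx <;>
      · obtain ⟨q, hq, rfl⟩ := Finset.mem_image.1 hx
        obtain ⟨p, hp, rfl⟩ := Finset.mem_image.1 hq
        first
        | exact (hmem p hp).1
        | exact (hmem p hp).2
  -- The letters cover `2 * m + 1` tokens from equally many positions, so they cannot repeat.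
  have hbij : Function.Bijective f := by
    refine (Fintype.bijective_iff_surjective_and_card f).2 ⟨hsurj, ?_⟩
    simp [Nat.mul_comm]
  refine ⟨(posEquiv m).symm.trans (Equiv.ofBijective f hbij), ?_⟩
  have hp : ∀ i : Fin m, dirOf (pairOf (e.symm i : DPair (2 * m + 1))) = e.symm i := fun i =>
    dirOf_pairOf (hlt _ (Finset.mem_image_of_mem (fun p : DPair (2 * m + 1) => (p.1, p.2.1))
      (e.symm i).2))
  ext p
  simp only [dirSet, pairSet, Finset.image_image, Finset.mem_image, Finset.mem_univ, true_and,
    Function.comp_apply, ← posEquiv_fst, ← posEquiv_snd, Equiv.trans_apply, Equiv.symm_apply_apply,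
    Equiv.ofBijective_apply]
  simp only [f, Sum.elim_inl, if_true, one_ne_zero, if_false, Prod.mk.eta, hp]
  constructor
  · rintro ⟨i, rfl⟩
    exact (e.symm i).2
  · intro h
    exact ⟨e ⟨p, h⟩, by simp⟩

theorem card_filter_dirSet {m : ℕ} (τ : Perm (Fin (2 * m + 1))) :
    (Finset.univ.filter fun σ : Perm (Fin (2 * m + 1)) => dirSet σ = dirSet τ).card =
      m.factorial := by
  have : (Finset.univ.filter fun σ : Perm (Fin (2 * m + 1)) => dirSet σ = dirSet τ) =
      Finset.univ.image fun π : Perm (Fin m) => τ * pairPerm π := by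
    ext σ
    simp only [Finset.mem_filter, Finset.mem_univ, true_and, Finset.mem_image, dirSet_eq_iff]
    constructor
    · exact exists_eq_mul_pairPerm
    · rintro ⟨π, rfl⟩
      exact pairSet_mul_pairPerm τ π
  rw [this, Finset.card_image_of_injective, Finset.card_univ, Fintype.card_perm, Fintype.card_fin]
  intro π π' h
  have h' := mul_left_cancel h
  ext i
  have := DFunLike.congr_fun h' (fstPos i)
  rw [pairPerm_fst, pairPerm_fst] at this
  exact congrArg Fin.val (fstPos_injective this)

theorem dirDist_dirOf {m : ℕ} (N : ℕ) (z : Fin (2 * m + 1) → ℕ)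
    (p : Fin (2 * m + 1) × Fin (2 * m + 1)) :
    dirDist N z (dirOf p) = clockDist N (fun i => (z i : ℤ)) p.1 p.2 := by
  unfold dirOf clockDist
  split_ifs with h
  · simp [dirDist]
  · simp [dirDist]
    ring

/-- The terms depend on a word only through its directed pairs, and each fibre has `m!` words, which
cancels the normalization. -/
theorem pfaff_eq_sum_directedPairings {m : ℕ} (P : ℝ → ℝ) (N : ℕ) (z : Fin (2 * m + 1) → ℕ) :
    pfaff P N (fun i => (z i : ℤ)) =
      ∑ w ∈ directedPairings (2 * m + 1), dirSign w * ∏ p ∈ w, P (dirDist N z p) := by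
  have hterm : ∀ σ : Perm (Fin (2 * m + 1)), ((sign σ : ℤ) : ℝ) *
      ∏ i : Fin m, P (clockDist N (fun i => (z i : ℤ)) (σ (fstPos i)) (σ (sndPos i))) =
      dirSign (dirSet σ) * ∏ p ∈ dirSet σ, P (dirDist N z p) := by
    intro σ
    rw [dirSign_dirSet, dirSet, Finset.prod_image fun x _ y _ h => dirOf_injective h, pairSet,
      Finset.prod_image fun x _ y _ h => pair_injective σ h]
    simp only [dirDist_dirOf]
  rw [pfaff, pairSum, Finset.sum_congr rfl fun σ _ => hterm σ, div_eq_iff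
    (Nat.cast_ne_zero.2 (Nat.factorial_ne_zero m)), Finset.sum_mul,
    ← Finset.sum_fiberwise_of_maps_to (t := directedPairings (2 * m + 1)) (g := dirSet)
      fun σ _ => dirSet_mem_directedPairings σ]
  refine Finset.sum_congr rfl fun w hw => ?_
  obtain ⟨τ, rfl⟩ := exists_dirSet_eq hw
  rw [Finset.sum_congr rfl fun σ hσ => by rw [(Finset.mem_filter.1 hσ).2], Finset.sum_const,
    card_filter_dirSet, nsmul_eq_mul, mul_comm]

/-! ### Summation over time -/

/-- Expanding the product of sums gives one geometric series for each tuple `j`. Its ratio is a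
nonempty product of numbers in (0, 1), hence less than 1. -/
theorem hasSum_prod_transient {N : ℕ} {r : ℝ} (hr₀ : 0 < r) (hr₁ : r < 1) {ι : Type*} [Fintype ι]
    [DecidableEq ι] [Nonempty ι] (y : ι → ℝ) :
    HasSum (fun t => -∏ i, transient N r t (y i)) (F N r y) := by
  have hprod : ∀ t, -∏ i, transient N r t (y i) = -(-1 / (N : ℝ)) ^ Fintype.card ι *
      ∑ j ∈ Fintype.piFinset (fun _ : ι => Finset.Icc 1 (N - 1)),
        (∏ i, g (j i) (y i) (1 / N)) * (∏ i, h r (j i) (1 / N)) ^ t := by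
    intro t
    unfold transient
    rw [Finset.prod_mul_distrib, Finset.prod_const, Finset.card_univ, Finset.prod_univ_sum, neg_mul]
    simp only [Finset.prod_mul_distrib, Finset.prod_pow]
  simp only [hprod]
  refine HasSum.mul_left _ (hasSum_sum fun j hj => ?_)
  rw [div_eq_mul_inv]
  refine HasSum.mul_left _ (hasSum_geometric_of_lt_one ?_ ?_)
  · exact Finset.prod_nonneg fun i _ => (h_mem_Ioo hr₀ hr₁ (Fintype.mem_piFinset.1 hj i)).1.le
  · have := Finset.prod_lt_prod_of_nonempty (s := (Finset.univ : Finset ι))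
      (f := fun i => h r (j i) (1 / N)) (g := fun _ => 1)
      (fun i _ => (h_mem_Ioo hr₀ hr₁ (Fintype.mem_piFinset.1 hj i)).1)
      (fun i _ => (h_mem_Ioo hr₀ hr₁ (Fintype.mem_piFinset.1 hj i)).2) Finset.univ_nonempty
    simpa using this

theorem hasSum_one_sub_stab {N : ℕ} [NeZero N] {r : ℝ} (hr₀ : 0 < r) (hr₁ : r < 1) {m : ℕ}
    {z : Fin (2 * m + 1) → ℕ} (hz : IsStrictCyclic N fun i => (z i : ℤ)) :
    HasSum (fun t => 1 - stab N r t (initial N z))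
      (∑ w ∈ directedPairings (2 * m + 1), dirSign w *
        ∑ x ∈ w.powerset.filter (fun x => x.Nonempty), F N r (yOf N z x) * G (yOf N z (w \ x))) := by
  have hinit : initial N z = oddSet N fun i => (z i : ℤ) := by
    rw [hz.oddSet_eq_image]
    simp [initial]
  have hlim := IsCyclic.pfaff_limit m _ hz.isCyclic
  rw [pfaff_eq_sum_directedPairings] at hlim
  have hterm : ∀ t, 1 - stab N r t (initial N z) = ∑ w ∈ directedPairings (2 * m + 1),
      dirSign w * ∑ x ∈ w.powerset.filter (fun x => x.Nonempty),
        (-∏ p : x, transient N r t (yOf N z x p)) * G (yOf N z (w \ x)) := by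
    intro t
    -- The constant 1 is rewritten as the sum for the affine part, to be subtracted pairing by
    -- pairing.
    rw [hinit, ← IsCyclic.pfaff_hit r t m _ hz.isCyclic, pfaff_eq_sum_directedPairings, ← hlim,
      ← Finset.sum_sub_distrib]
    refine Finset.sum_congr rfl fun w _ => ?_
    rw [← mul_sub]
    congr 1
    have hhit : ∀ p, hit N r t (dirDist N z p) =
        transient N r t (dirDist N z p / N) + (1 - dirDist N z p / N) := fun p => add_comm _ _
    simp only [hhit]
    -- Here `x` is the set of pairs that contribute a transient factor; the term of `∅` cancels
    -- against the affine product.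
    rw [Finset.prod_add, ← Finset.add_sum_erase _ _ (Finset.empty_mem_powerset w)]
    have hfilter : w.powerset.filter (fun x => x.Nonempty) = w.powerset.erase ∅ := by
      ext x
      simp [Finset.nonempty_iff_ne_empty, and_comm]
    rw [hfilter]
    simp only [Finset.prod_empty, Finset.sdiff_empty, one_mul, sub_add_cancel_left, neg_mul,
      Finset.sum_neg_distrib, G, yOf]
    congr 1
    refine Finset.sum_congr rfl fun x _ => ?_
    rw [Finset.prod_coe_sort x fun p => transient N r t (dirDist N z p / N),
      Finset.prod_coe_sort (w \ x) fun p => 1 - dirDist N z p / N]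
  simp only [hterm]
  refine hasSum_sum fun w _ => HasSum.mul_left _ (hasSum_sum fun x hx => HasSum.mul_right _ ?_)
  have : Nonempty x := (Finset.mem_filter.1 hx).2.to_subtype
  exact hasSum_prod_transient hr₀ hr₁ _

end Herman

/-! ### The expected stabilization time -/

theorem mainTheorem6 {Ω : Type*} [MeasurableSpace Ω] (μ : Measure Ω) [IsProbabilityMeasure μ]
    (N : ℕ) (hN : Odd N) (r : ℝ) (hr₀ : 0 < r) (hr₁ : r < 1)
    (M : ℕ) (hM : Odd M) (hM₃ : 3 ≤ M)
    (z : Fin M → ℕ) (hz : StrictMono z) (hzN : ∀ i, 1 ≤ z i ∧ z i ≤ N)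
    (coin : ℕ → ZMod N → Ω → Bool) (hcoin : Herman.IsCoinFamily μ N r coin) :
    Herman.expectedTime μ (Herman.initial N z) coin ≠ ⊤ ∧
    (Herman.expectedTime μ (Herman.initial N z) coin).toReal =
      ∑ w ∈ Herman.directedPairings M, Herman.dirSign w *
        ∑ x ∈ w.powerset.filter (fun x => x.Nonempty),
          Herman.F N r (Herman.yOf N z x) * Herman.G (Herman.yOf N z (w \ x)) := by
  obtain ⟨m, rfl⟩ := hM
  have : NeZero N := ⟨hN.pos.ne'⟩
  have hstrict : Herman.IsStrictCyclic N fun i => (z i : ℤ) := by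
    refine ⟨fun i j hij => ?_, ?_⟩
    · exact_mod_cast hz hij
    · have h₀ := hzN 0
      have h₁ := hzN (Fin.last (2 * m))
      show (z (Fin.last (2 * m)) : ℤ) < z 0 + N
      omega
  exact hcoin.expectedTime_of_hasSum hr₀.le _ (Herman.hasSum_one_sub_stab hr₀ hr₁ hstrict)
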